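/- For $j=1,2$ let $\Omega_j\subset\mathbb{C}^{n_j}$ be a bounded domain with Lipschitz boundary (near each boundary point it is, in suitable holomorphic coordinates, one side of the graph of a Lipschitz function), and let $\varphi_j$ be a real function continuous on $\overline{\Omega_j}$. Let $L^2_*(\Omega_j)$ be the Hilbert space of forms $\sum_{I,J}f_{I,J}\,dz^I\wedge d\bar z^J$ ($I,J$ strictly increasing) of all bidegrees, with $\|f\|^2=\sum_{I,J}\int_{\Omega_j}|f_{I,J}|^2e^{-\varphi_j}dV$. Let $\overline\partial_j$ be the closed, densely defined operator on $L^2_*(\Omega_j)$ that is $\overline\partial$ in the sense of distributions, with domain all $f\in L^2_*(\Omega_j)$ such that $\overline\partial f\in L^2_*(\Omega_j)$, and assume that $\overline\partial_1$ and $\overline\partial_2$ have closed range (in all degrees). Define $L^2_*(\Omega)$ and $\overline\partial$ in the same way on the product $\Omega=\Omega_1\times\Omega_2$ with weight $\varphi_1(z)+\varphi_2(w)$, and identify $L^2_*(\Omega)$ with the Hilbert tensor product $L^2_*(\Omega_1)\widehat\otimes L^2_*(\Omega_2)$ through $f\otimes g=\pi_1^*f\wedge\pi_2^*g$, where $\pi_j:\Omega\to\Omega_j$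 are the projections. A form is harmonic if it lies in $\ker\overline\partial\cap\ker\overline\partial^*$, where $\overline\partial^*$ is the Hilbert space adjoint. If $\overline\partial$ has closed range, the canonical solution operator $K$ is the bounded operator that sends $f\in\operatorname{im}\overline\partial$ to the solution $u$ of $\overline\partial u=f$ orthogonal to $\ker\overline\partial$, and that vanishes on $(\operatorname{im}\overline\partial)^\perp$; the $\overline\partial$-Neumann operator $\mathsf N$ is the bounded operator such that, for every $f$, $\mathsf Nf$ is orthogonal to the harmonic forms and $(\overline\partial\,\overline\partial^*+\overline\partial^*\overline\partial)\mathsf Nf=f-Pf$, where $P$ is the orthogonal projection onto the harmonic forms. Let $K_j$ and $P_j$ be the canonical solution operator and the harmonic projection on $\Omega_j$, $I_2$ the identity on $L^2_*(\Omega_2)$, $\sigma_1$ the multiplication by $(-1)^{p+q}$ on $(p,q)$-forms on $\Omega_1$, and $$S=K_1\widehat\otimes I_2+\sigma_1P_1\widehat\otimes K_2 ,$$ a bounded operator on $L^2_*(\Omega)$. Theorem. The operator $\overline\partial$ on $\Omega$ has closed range, so that $K$ and $\mathsf N$ exist on $\Omega$, and for every $p\ge 0$: (a) for every $\overline\partial$-closed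 $(p,1)$-form $f\in L^2_*(\Omega)$, $\mathsf Nf$ lies in the domain of $\overline\partial^*$ and $Sf=\overline\partial^*\mathsf Nf=Kf$; (b) $Sf=0$ for every harmonic $(p,1)$-form $f\in L^2_*(\Omega)$; (c) $Sf$ is orthogonal to $\ker\overline\partial$ for every $(p,1)$-form $f\in L^2_*(\Omega)$. -/

import Mathlib

open MeasureTheory
open scoped ENNReal NNReal ContDiff TensorProduct InnerProductSpace LinearPMap

noncomputable section

/-! ### Closed operators on a Hilbert space -/

section HilbertComplex

variable {H : Type*} [NormedAddCommGroup H] [InnerProductSpace ℂ H] 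

/-- The kernel of a partially defined operator, as a subspace of the ambient space. -/
def kerOp (T : H →ₗ.[ℂ] H) : Submodule ℂ H := (LinearMap.ker T.toFun).map T.domain.subtype

/-- The range of a partially defined operator. -/
def rangeOp (T : H →ₗ.[ℂ] H) : Submodule ℂ H := LinearMap.range T.toFun

theorem mem_kerOp {T : H →ₗ.[ℂ] H} {x : H} : x ∈ kerOp T ↔ (x, (0 : H)) ∈ T.graph := by
  simp [kerOp, LinearPMap.mem_graph_iff]

theorem isClosed_kerOp {T : H →ₗ.[ℂ] H} (hT : T.IsClosed) : IsClosed (kerOp T : Set H) := by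
  have : (kerOp T : Set H) = (fun x : H => (x, (0 : H))) ⁻¹' (T.graph : Set (H × H)) := by
    ext x; exact mem_kerOp
  rw [this]
  exact IsClosed.preimage (by fun_prop) hT

variable [CompleteSpace H]

/-- `T` is a closed, densely defined operator. -/
structure ClosedDenselyDefined (T : H →ₗ.[ℂ] H) : Prop where
  isClosed : T.IsClosed
  dense : Dense (T.domain : Set H)

/-- The harmonic space `ker T ∩ ker T†`. -/
def harmonicSpace (T : H →ₗ.[ℂ] H) : Submodule ℂ H := kerOp T ⊓ kerOp T†

/-- If `T` is closed with closed range, every `g` in the range of `T` has a unique preimage that is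
orthogonal to `ker T`. -/
theorem existsUnique_minimal {T : H →ₗ.[ℂ] H} (hT : T.IsClosed) (g : rangeOp T) :
    ∃! u : H, (u, (g : H)) ∈ T.graph ∧ u ∈ (kerOp T)ᗮ := by
  have hc : IsComplete (kerOp T : Set H) := (isClosed_kerOp hT).isComplete
  have : CompleteSpace (kerOp T) := completeSpace_coe_iff_isComplete.2 hc
  obtain ⟨_, ⟨x, rfl⟩⟩ := g
  refine ⟨(x : H) - (kerOp T).starProjection x, ⟨?_, ?_⟩, ?_⟩
  · have h1 : ((x : H), T x) ∈ T.graph := T.mem_graph x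
    have h2 := mem_kerOp.1 ((kerOp T).starProjection_apply_mem (x : H))
    simpa using T.graph.sub_mem h1 h2
  · exact (kerOp T).sub_starProjection_mem_orthogonal (x : H)
  · rintro u ⟨hu, hu'⟩
    have h1 : ((x : H), T x) ∈ T.graph := T.mem_graph x
    have h2 := mem_kerOp.1 ((kerOp T).starProjection_apply_mem (x : H))
    have h3 : u - ((x : H) - (kerOp T).starProjection x) ∈ kerOp T := by
      rw [mem_kerOp]
      simpa using T.graph.sub_mem hu (T.graph.sub_mem h1 h2)
    have h4 : u - ((x : H) - (kerOp T).starProjection x) ∈ (kerOp T)ᗮ :=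
      Submodule.sub_mem _ hu' ((kerOp T).sub_starProjection_mem_orthogonal (x : H))
    have := Submodule.inner_right_of_mem_orthogonal h3 h4
    exact sub_eq_zero.1 (inner_self_eq_zero.1 this)

/-- The minimal solution of `T u = g` for `g` in the range of `T`, as a linear map. -/
def minimalSolution {T : H →ₗ.[ℂ] H} (hT : T.IsClosed) : rangeOp T →ₗ[ℂ] H where
  toFun g := (existsUnique_minimal hT g).choose
  map_add' g g' := by
    have h := (existsUnique_minimal hT g).choose_spec.1
    have h' := (existsUnique_minimal hT g').choose_spec.1
    refine ((existsUnique_minimal hT (g + g')).choose_spec.2 _ ⟨?_, ?_⟩).symm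
    · simpa using T.graph.add_mem h.1 h'.1
    · exact Submodule.add_mem _ h.2 h'.2
  map_smul' c g := by
    have h := (existsUnique_minimal hT g).choose_spec.1
    refine ((existsUnique_minimal hT (c • g)).choose_spec.2 _ ⟨?_, ?_⟩).symm
    · simpa using T.graph.smul_mem c h.1
    · exact Submodule.smul_mem _ c h.2

theorem minimalSolution_spec {T : H →ₗ.[ℂ] H} (hT : T.IsClosed) (g : rangeOp T) :
    (minimalSolution hT g, (g : H)) ∈ T.graph ∧ minimalSolution hT g ∈ (kerOp T)ᗮ :=
  (existsUnique_minimal hT g).choose_spec.1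

theorem continuous_minimalSolution {T : H →ₗ.[ℂ] H} (hT : T.IsClosed)
    (hR : IsClosed (rangeOp T : Set H)) : Continuous (minimalSolution hT) := by
  have : CompleteSpace (rangeOp T) := completeSpace_coe_iff_isComplete.2 hR.isComplete
  apply LinearMap.continuous_of_isClosed_graph
  have : ((minimalSolution hT).graph : Set (rangeOp T × H)) =
      (fun y : rangeOp T × H => (y.2, (y.1 : H))) ⁻¹' (T.graph : Set (H × H)) ∩
        (fun y : rangeOp T × H => y.2) ⁻¹' (((kerOp T)ᗮ : Submodule ℂ H) : Set H) := by
    ext ⟨g, u⟩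
    rw [Set.mem_inter_iff]
    simp only [SetLike.mem_coe, LinearMap.mem_graph_iff, Set.mem_preimage]
    constructor
    · rintro rfl; exact minimalSolution_spec hT g
    · intro h
      exact (existsUnique_minimal hT g).unique h (minimalSolution_spec hT g)
  rw [this]
  exact (IsClosed.preimage (by fun_prop) hT).inter
    (IsClosed.preimage (by fun_prop) (Submodule.isClosed_orthogonal _))

/-- The canonical solution operator of a closed operator `T` with closed range: on the range of
`T`, `K g` is the solution of `T u = g` orthogonal to `ker T`; `K = 0` on `(range T)ᗮ`. -/
def canonicalSolution {T : H →ₗ.[ℂ] H} (hT : ClosedDenselyDefined T)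
    (hR : IsClosed (rangeOp T : Set H)) : H →L[ℂ] H :=
  haveI : CompleteSpace (rangeOp T) := completeSpace_coe_iff_isComplete.2 hR.isComplete
  (⟨minimalSolution hT.isClosed, continuous_minimalSolution hT.isClosed hR⟩ : rangeOp T →L[ℂ] H) ∘L
    (rangeOp T).orthogonalProjectionOnto

theorem isClosed_harmonicSpace {T : H →ₗ.[ℂ] H} (hT : ClosedDenselyDefined T) :
    IsClosed (harmonicSpace T : Set H) :=
  (isClosed_kerOp hT.isClosed).inter (isClosed_kerOp (LinearPMap.adjoint_isClosed hT.dense))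

/-- The orthogonal projection onto the harmonic space. -/
def harmonicProjection {T : H →ₗ.[ℂ] H} (hT : ClosedDenselyDefined T) : H →L[ℂ] H :=
  haveI : CompleteSpace (harmonicSpace T) :=
    completeSpace_coe_iff_isComplete.2 (isClosed_harmonicSpace hT).isComplete
  (harmonicSpace T).starProjection

/-- `□ u = f`, where `□ = T T† + T† T` on its natural domain. -/
def IsBox (T : H →ₗ.[ℂ] H) (u f : H) : Prop :=
  ∃ v w a b : H, (u, v) ∈ T†.graph ∧ (v, a) ∈ T.graph ∧ (u, w) ∈ T.graph ∧ (w, b) ∈ T†.graph ∧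
    f = a + b

/-- `N` is the `T`-Neumann operator: `N f` is the solution `u` of `□ u = f - P f` orthogonal to the
harmonic space, where `P` is the harmonic projection. These conditions determine `N`. -/
def IsNeumannOperator {T : H →ₗ.[ℂ] H} (hT : ClosedDenselyDefined T) (N : H →L[ℂ] H) : Prop :=
  ∀ f : H, IsBox T (N f) (f - harmonicProjection hT f) ∧ N f ∈ (harmonicSpace T)ᗮ

end HilbertComplex

/-! ### Weighted domains and square integrable forms -/

/-- A bounded domain in `ℂ^ι` with a weight function that is continuous on the closure. -/
structure WeightedDomain (ι : Type*) [Fintype ι] where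
  carrier : Set (ι → ℂ)
  isOpen : IsOpen carrier
  isConnected : IsConnected carrier
  isBounded : Bornology.IsBounded carrier
  weight : (ι → ℂ) → ℝ
  continuousOn_weight : ContinuousOn weight (closure carrier)

/-- `D` has Lipschitz boundary: near each boundary point there are holomorphic coordinates `e` in
which `D` lies on one side of the graph of a Lipschitz function `g`, which expresses the real part
of one complex coordinate through the remaining real coordinates. -/
def HasLipschitzBoundary {ι : Type*} [Fintype ι] [DecidableEq ι] (D : Set (ι → ℂ)) : Prop :=
  ∀ a ∈ frontier D, ∃ e : OpenPartialHomeomorph (ι → ℂ) (ι → ℂ),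
    a ∈ e.source ∧ DifferentiableOn ℂ e e.source ∧ DifferentiableOn ℂ e.symm e.target ∧
    ∃ (k : ι) (C : ℝ≥0) (g : (ι → ℂ) → ℝ), LipschitzWith C g ∧
      (∀ (w : ι → ℂ) (t : ℝ), g (w + Pi.single k (t : ℂ)) = g w) ∧
      ∀ z ∈ e.source, z ∈ D ↔ g (e z) < (e z k).re

namespace WeightedDomain

section Single

variable {ι : Type*} [Fintype ι] (Ω : WeightedDomain ι)

/-- The measure `e^{-φ} dV` on the domain. -/
def measure : Measure (ι → ℂ) :=
  (volume.restrict Ω.carrier).withDensity fun z => ENNReal.ofReal (Real.exp (-Ω.weight z))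

/-- `L²` forms of all bidegrees. The entry at `(I, J)` is the coefficient of `dz^I ∧ dz̄^J`, where
finite sets of indices stand for strictly increasing multi-indices; the monomials
`dz^I ∧ dz̄^J` are pointwise orthonormal. -/
abbrev L2Forms : Type _ := PiLp 2 fun _ : Finset ι × Finset ι => Lp ℂ 2 Ω.measure

theorem continuousOn_weight' : ContinuousOn Ω.weight Ω.carrier :=
  Ω.continuousOn_weight.mono subset_closure

theorem aemeasurable_density : AEMeasurable
    (fun z => ENNReal.ofReal (Real.exp (-Ω.weight z))) (volume.restrict Ω.carrier) := by
  have : ContinuousOn (fun z => Real.exp (-Ω.weight z)) Ω.carrier :=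
    (Ω.continuousOn_weight'.neg).rexp
  exact (this.aemeasurable Ω.isOpen.measurableSet).ennreal_ofReal

theorem isCompact_closure : IsCompact (closure Ω.carrier) := Ω.isBounded.isCompact_closure

theorem exists_exp_le : ∃ C : ℝ, ∀ z ∈ Ω.carrier,
    Real.exp (-Ω.weight z) ≤ C ∧ Real.exp (Ω.weight z) ≤ C := by
  obtain ⟨C, hC⟩ := Ω.isCompact_closure.exists_bound_of_continuousOn Ω.continuousOn_weight
  refine ⟨Real.exp C, fun z hz => ?_⟩
  have h := abs_le.1 (hC z (subset_closure hz))
  constructor <;> apply Real.exp_le_exp.2 <;> linarith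

theorem measure_absolutelyContinuous : Ω.measure ≪ volume.restrict Ω.carrier :=
  withDensity_absolutelyContinuous _ _

theorem absolutelyContinuous_measure : volume.restrict Ω.carrier ≪ Ω.measure :=
  withDensity_absolutelyContinuous' Ω.aemeasurable_density
    (Filter.Eventually.of_forall fun z => by simp [Real.exp_pos])

instance : IsFiniteMeasure Ω.measure := by
  obtain ⟨C, hC⟩ := Ω.exists_exp_le
  apply isFiniteMeasure_withDensity
  have h1 : ∫⁻ z in Ω.carrier, ENNReal.ofReal (Real.exp (-Ω.weight z)) ≤
      ∫⁻ _ in Ω.carrier, ENNReal.ofReal C :=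
    setLIntegral_mono measurable_const fun z hz => ENNReal.ofReal_le_ofReal (hC z hz).1
  refine (h1.trans_lt ?_).ne
  rw [setLIntegral_const]
  exact ENNReal.mul_lt_top ENNReal.ofReal_lt_top Ω.isBounded.measure_lt_top

theorem memLp_test {h : (ι → ℂ) → ℂ} (hc : Continuous h) (hs : HasCompactSupport h) :
    MemLp (fun z => (Real.exp (Ω.weight z) : ℂ) * (starRingEnd ℂ) (h z)) 2 Ω.measure := by
  obtain ⟨C, hC⟩ := Ω.exists_exp_le
  obtain ⟨B, hB⟩ := hs.exists_bound_of_continuous hc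
  have hco : ContinuousOn (fun z => (Real.exp (Ω.weight z) : ℂ) * (starRingEnd ℂ) (h z))
      Ω.carrier :=
    (Complex.continuous_ofReal.comp_continuousOn Ω.continuousOn_weight'.rexp).mul
      (Complex.continuous_conj.comp hc).continuousOn
  refine MemLp.of_bound ((hco.aestronglyMeasurable Ω.isOpen.measurableSet).mono_ac
    Ω.measure_absolutelyContinuous) (C * B) ?_
  refine Ω.measure_absolutelyContinuous.ae_le ?_
  filter_upwards [ae_restrict_mem Ω.isOpen.measurableSet] with z hz
  rw [norm_mul, RCLike.norm_conj, Complex.norm_real, Real.norm_eq_abs, abs_of_pos (Real.exp_pos _)]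
  exact mul_le_mul (hC z hz).2 (hB z) (norm_nonneg _) ((Real.exp_pos _).le.trans (hC z hz).2)

/-- Integrals against Lebesgue measure are weighted integrals. -/
theorem setIntegral_eq (f : (ι → ℂ) → ℂ) :
    ∫ z in Ω.carrier, f z = ∫ z, (Real.exp (Ω.weight z) : ℂ) * f z ∂Ω.measure := by
  rw [measure, integral_withDensity_eq_integral_toReal_smul₀ Ω.aemeasurable_density
    (Filter.Eventually.of_forall fun z => ENNReal.ofReal_lt_top)]
  congr 1 with z
  rw [ENNReal.toReal_ofReal (Real.exp_pos _).le, Complex.real_smul, ← mul_assoc,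
    ← Complex.ofReal_mul, ← Real.exp_add]
  simp

/-- Lebesgue pairing with a continuous compactly supported function is an inner product. -/
theorem setIntegral_mul_eq_inner {h : (ι → ℂ) → ℂ} (hc : Continuous h) (hs : HasCompactSupport h)
    (f : Lp ℂ 2 Ω.measure) :
    ∫ z in Ω.carrier, f z * h z = ⟪(Ω.memLp_test hc hs).toLp _, f⟫_ℂ := by
  rw [setIntegral_eq, L2.inner_def]
  apply integral_congr_ae
  filter_upwards [(Ω.memLp_test hc hs).coeFn_toLp] with z hz
  rw [hz]
  simp [Complex.conj_ofReal, -Complex.ofReal_exp]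
  ring

/-- A smooth function with compact support in the domain. -/
structure IsTest (ψ : (ι → ℂ) → ℂ) : Prop where
  contDiff : ContDiff ℝ ∞ ψ
  hasCompactSupport : HasCompactSupport ψ
  tsupport_subset : tsupport ψ ⊆ Ω.carrier

theorem integrable_smul (f : Lp ℂ 2 Ω.measure) : Integrable
    (fun z => Real.exp (-Ω.weight z) • f z) (volume.restrict Ω.carrier) := by
  have h1 : Integrable (fun z => f z) Ω.measure := (Lp.memLp f).integrable (by norm_num)
  have h2 := (integrable_withDensity_iff_integrable_smul₀' Ω.aemeasurable_density
    (Filter.Eventually.of_forall fun z => ENNReal.ofReal_lt_top)).1 h1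
  simpa only [ENNReal.toReal_ofReal (Real.exp_pos _).le] using h2

theorem integrableOn (f : Lp ℂ 2 Ω.measure) : IntegrableOn (fun z => f z) Ω.carrier := by
  obtain ⟨C, hC⟩ := Ω.exists_exp_le
  refine ((Ω.integrable_smul f).norm.const_mul C).mono'
    ((Lp.aestronglyMeasurable f).mono_ac Ω.absolutelyContinuous_measure) ?_
  filter_upwards [ae_restrict_mem Ω.isOpen.measurableSet] with z hz
  rw [norm_smul, Real.norm_eq_abs, abs_of_pos (Real.exp_pos _), ← mul_assoc]
  refine le_mul_of_one_le_left (norm_nonneg _) ?_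
  calc (1 : ℝ) = Real.exp (Ω.weight z) * Real.exp (-Ω.weight z) := by
        rw [← Real.exp_add]; simp
    _ ≤ _ := mul_le_mul_of_nonneg_right (hC z hz).2 (Real.exp_pos _).le

theorem ae_eq_zero_of_pairing {f : (ι → ℂ) → ℂ} (hint : IntegrableOn f Ω.carrier)
    (hf : ∀ ψ, Ω.IsTest ψ → ∫ z in Ω.carrier, f z * ψ z = 0) :
    ∀ᵐ z ∂Ω.measure, f z = 0 := by
  have key := Ω.isOpen.ae_eq_zero_of_integral_contDiff_smul_eq_zero
    (hint.locallyIntegrableOn) (fun g hg hgs hgt => by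
      have h := hf (fun z => (g z : ℂ)) ⟨Complex.ofRealCLM.contDiff.comp hg,
        hgs.comp_left (g := fun x : ℝ => (x : ℂ)) (by simp),
        (tsupport_comp_subset (g := fun x : ℝ => (x : ℂ)) (by simp) g).trans hgt⟩
      rw [← h, setIntegral_eq_integral_of_forall_compl_eq_zero]
      · exact integral_congr_ae (Filter.Eventually.of_forall fun z => by
          simp [Complex.real_smul, mul_comm])
      · intro z hz
        have : g z = 0 := image_eq_zero_of_notMem_tsupport fun h' => hz (hgt h')
        simp [this])
  rw [← ae_restrict_iff' Ω.isOpen.measurableSet] at key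
  exact Ω.measure_absolutelyContinuous.ae_le key

theorem eq_zero_of_pairing {f : Lp ℂ 2 Ω.measure}
    (hf : ∀ ψ, Ω.IsTest ψ → ∫ z in Ω.carrier, f z * ψ z = 0) : f = 0 :=
  (Lp.eq_zero_iff_ae_eq_zero).2 (Ω.ae_eq_zero_of_pairing (Ω.integrableOn f) hf)

variable {Ω} in
/-- Lebesgue pairing with a test function, as a continuous linear functional. -/
theorem IsTest.exists_clm {ψ : (ι → ℂ) → ℂ} (h : Ω.IsTest ψ) :
    ∃ T : Lp ℂ 2 Ω.measure →L[ℂ] ℂ, ∀ f, T f = ∫ z in Ω.carrier, f z * ψ z :=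
  ⟨innerSL ℂ ((Ω.memLp_test h.contDiff.continuous h.hasCompactSupport).toLp _), fun f =>
    (Ω.setIntegral_mul_eq_inner h.contDiff.continuous h.hasCompactSupport f).symm⟩

/-- The forms of bidegree `(p, q)`. -/
def bidegree (p q : ℕ) : Submodule ℂ Ω.L2Forms where
  carrier := {f | ∀ I J : Finset ι, ¬(I.card = p ∧ J.card = q) → f (I, J) = 0}
  zero_mem' _ _ _ := rfl
  add_mem' hf hg I J h := by simp [hf I J h, hg I J h]
  smul_mem' c f hf I J h := by simp [hf I J h]

/-- The operator `σ`: multiplication by `(-1)^{p+q}` on forms of bidegree `(p, q)`. -/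
def sigma : Ω.L2Forms →L[ℂ] Ω.L2Forms :=
  (PiLp.continuousLinearEquiv 2 ℂ (fun _ : Finset ι × Finset ι => Lp ℂ 2 Ω.measure)).symm ∘L
    ContinuousLinearMap.pi fun A => ((-1 : ℂ) ^ (A.1.card + A.2.card)) •
      PiLp.proj 2 (fun _ : Finset ι × Finset ι => Lp ℂ 2 Ω.measure) A

theorem sigma_apply (f : Ω.L2Forms) (A : Finset ι × Finset ι) :
    Ω.sigma f A = (-1 : ℂ) ^ (A.1.card + A.2.card) • f A := rfl

end Single

/-! ### The `∂̄` operator -/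

section Dbar

variable {ι : Type*} [Fintype ι] [LinearOrder ι] (Ω : WeightedDomain ι)

/-- The Wirtinger derivative `∂ψ/∂z̄_k`. -/
def dzbar (k : ι) (ψ : (ι → ℂ) → ℂ) (z : ι → ℂ) : ℂ :=
  (1 / 2) * (fderiv ℝ ψ z (Pi.single k 1) + Complex.I * fderiv ℝ ψ z (Pi.single k Complex.I))

/-- The sign in `dz̄_k ∧ dz^I ∧ dz̄^{L \ k} = ± dz^I ∧ dz̄^L`, for `k ∈ L`. -/
def dbarSign (k : ι) (I L : Finset ι) : ℂ := (-1) ^ (I.card + (L.filter (· < k)).card)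

/-- `∂̄ f = g` in the sense of distributions: for all `I` and `L`,
`g_{I,L} = ∑_{k ∈ L} ± ∂f_{I, L \ k}/∂z̄_k` weakly on the domain. -/
def IsWeakDbar (f g : Ω.L2Forms) : Prop :=
  ∀ I L : Finset ι, ∀ ψ, Ω.IsTest ψ →
    ∫ z in Ω.carrier, g (I, L) z * ψ z =
      -∑ k ∈ L, dbarSign k I L * ∫ z in Ω.carrier, f (I, L.erase k) z * dzbar k ψ z

variable {Ω}

theorem IsTest.dzbar {ψ : (ι → ℂ) → ℂ} (h : Ω.IsTest ψ) (k : ι) : Ω.IsTest (dzbar k ψ) := by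
  have h1 : ∀ v, ContDiff ℝ ∞ (fun z => fderiv ℝ ψ z v) := fun v =>
    (h.contDiff.fderiv_right (m := ∞) (by simp)).clm_apply contDiff_const
  have hs : tsupport (WeightedDomain.dzbar k ψ) ⊆ tsupport ψ := by
    refine closure_minimal (fun z hz => ?_) (isClosed_tsupport ψ)
    by_contra hz'
    have h0 : fderiv ℝ ψ z = 0 :=
      image_eq_zero_of_notMem_tsupport fun h' => hz' (tsupport_fderiv_subset ℝ h')
    exact hz (by simp [WeightedDomain.dzbar, h0])
  refine ⟨?_, h.hasCompactSupport.mono' ((subset_tsupport _).trans hs), hs.trans h.tsupport_subset⟩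
  exact contDiff_const.mul ((h1 _).add (contDiff_const.mul (h1 _)))

/-- The defect functional of the weak equation `∂̄ f = g`. -/
theorem exists_defect_clm (I L : Finset ι) {ψ : (ι → ℂ) → ℂ} (h : Ω.IsTest ψ) :
    ∃ T : Ω.L2Forms × Ω.L2Forms →L[ℂ] ℂ, ∀ x, T x =
      (∫ z in Ω.carrier, x.2 (I, L) z * ψ z) +
      ∑ k ∈ L, dbarSign k I L * ∫ z in Ω.carrier, x.1 (I, L.erase k) z * WeightedDomain.dzbar k ψ z := by
  choose T hT using fun k => (h.dzbar k).exists_clm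
  obtain ⟨T₀, hT₀⟩ := h.exists_clm
  refine ⟨T₀ ∘L (PiLp.proj 2 _ (I, L)) ∘L ContinuousLinearMap.snd ℂ _ _ +
    ∑ k ∈ L, dbarSign k I L •
      (T k ∘L (PiLp.proj 2 _ (I, L.erase k)) ∘L ContinuousLinearMap.fst ℂ _ _), fun x => ?_⟩
  simp [hT, hT₀]

variable (Ω)

/-- The graph of `∂̄`. -/
def dbarGraph : Submodule ℂ (Ω.L2Forms × Ω.L2Forms) where
  carrier := {x | Ω.IsWeakDbar x.1 x.2}
  zero_mem' I L ψ h := by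
    obtain ⟨T, hT⟩ := exists_defect_clm I L h
    have := hT 0
    rw [map_zero] at this
    exact eq_neg_of_add_eq_zero_left this.symm
  add_mem' {x y} hx hy I L ψ h := by
    obtain ⟨T, hT⟩ := exists_defect_clm I L h
    apply eq_neg_of_add_eq_zero_left
    rw [← hT, map_add, hT, hT, hx I L ψ h, hy I L ψ h]
    simp
  smul_mem' c x hx I L ψ h := by
    obtain ⟨T, hT⟩ := exists_defect_clm I L h
    apply eq_neg_of_add_eq_zero_left
    rw [← hT, map_smul, hT, hx I L ψ h]
    simp

/-- The `L²` operator `∂̄`: its domain consists of the forms `f` in `L²` whose distributional `∂̄ f`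
is in `L²`. -/
def dbar : Ω.L2Forms →ₗ.[ℂ] Ω.L2Forms := Ω.dbarGraph.toLinearPMap

theorem dbarGraph_functional (x : Ω.L2Forms × Ω.L2Forms) (hx : x ∈ Ω.dbarGraph) (h0 : x.1 = 0) :
    x.2 = 0 := by
  have h0' : Ω.IsWeakDbar 0 0 := Ω.dbarGraph.zero_mem
  ext1 ⟨I, L⟩
  refine Ω.eq_zero_of_pairing fun ψ hψ => ?_
  obtain ⟨T, hT⟩ := hψ.exists_clm
  rw [hx I L ψ hψ, h0, ← h0' I L ψ hψ, PiLp.zero_apply, ← hT, map_zero]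

theorem dbar_graph : Ω.dbar.graph = Ω.dbarGraph :=
  Submodule.toLinearPMap_graph_eq _ Ω.dbarGraph_functional

theorem mem_dbar_graph {f g : Ω.L2Forms} : (f, g) ∈ Ω.dbar.graph ↔ Ω.IsWeakDbar f g := by
  rw [dbar_graph]; rfl

theorem dbar_isClosed : Ω.dbar.IsClosed := by
  rw [LinearPMap.IsClosed, dbar_graph]
  have : (Ω.dbarGraph : Set (Ω.L2Forms × Ω.L2Forms)) = ⋂ (I : Finset ι) (L : Finset ι)
      (ψ : (ι → ℂ) → ℂ) (h : Ω.IsTest ψ),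
      {x | (exists_defect_clm I L h).choose x = 0} := by
    ext x
    simp only [Set.mem_iInter]
    refine forall₄_congr fun I L ψ h => ?_
    rw [Set.mem_ofPred, (exists_defect_clm I L h).choose_spec, add_eq_zero_iff_eq_neg]
  rw [this]
  refine isClosed_iInter fun I => isClosed_iInter fun L => isClosed_iInter fun ψ =>
    isClosed_iInter fun h => isClosed_eq (ContinuousLinearMap.continuous _) continuous_const

variable {Ω} in
theorem IsTest.integral_dzbar {ψ χ : (ι → ℂ) → ℂ} (hψ : Ω.IsTest ψ) (hχ : Ω.IsTest χ) (k : ι) :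
    ∫ z in Ω.carrier, WeightedDomain.dzbar k χ z * ψ z =
      -∫ z in Ω.carrier, χ z * WeightedDomain.dzbar k ψ z := by
  have hi : ∀ {a b : (ι → ℂ) → ℂ}, Continuous a → Continuous b → HasCompactSupport b →
      Integrable (fun z => a z * b z) := fun ha hb hs =>
    (ha.mul hb).integrable_of_hasCompactSupport hs.mul_left
  have hd : ∀ {a : (ι → ℂ) → ℂ}, Ω.IsTest a → ∀ v, Continuous (fun z => fderiv ℝ a z v) :=
    fun ha v => (ha.contDiff.continuous_fderiv (by simp)).clm_apply continuous_const
  have hs : ∀ {a : (ι → ℂ) → ℂ}, Ω.IsTest a → ∀ v, HasCompactSupport (fun z => fderiv ℝ a z v) :=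
    fun ha v => ha.hasCompactSupport.fderiv_apply ℝ v
  have hv : ∀ v, ∫ z, fderiv ℝ χ z v * ψ z = -∫ z, χ z * fderiv ℝ ψ z v := fun v => by
    rw [integral_mul_fderiv_eq_neg_fderiv_mul_of_integrable, neg_neg]
    · exact hi (hd hχ v) hψ.contDiff.continuous hψ.hasCompactSupport
    · exact hi hχ.contDiff.continuous (hd hψ v) (hs hψ v)
    · exact hi hχ.contDiff.continuous hψ.contDiff.continuous hψ.hasCompactSupport
    · exact fun x _ => hχ.contDiff.differentiable (by simp) x
    · exact fun x _ => hψ.contDiff.differentiable (by simp) x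
  have e0 : ∀ z ∉ Ω.carrier, ψ z = 0 := fun z hz =>
    image_eq_zero_of_notMem_tsupport fun h' => hz (hψ.tsupport_subset h')
  have e1 : ∀ z ∉ Ω.carrier, χ z = 0 := fun z hz =>
    image_eq_zero_of_notMem_tsupport fun h' => hz (hχ.tsupport_subset h')
  rw [setIntegral_eq_integral_of_forall_compl_eq_zero fun z hz => by simp [e0 z hz],
    setIntegral_eq_integral_of_forall_compl_eq_zero fun z hz => by simp [e1 z hz]]
  have l : ∀ z, WeightedDomain.dzbar k χ z * ψ z = (1 / 2) *
      (fderiv ℝ χ z (Pi.single k 1) * ψ z + Complex.I * (fderiv ℝ χ z (Pi.single k Complex.I) * ψ z)) :=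
    fun z => by simp only [WeightedDomain.dzbar]; ring
  have r : ∀ z, χ z * WeightedDomain.dzbar k ψ z = (1 / 2) *
      (χ z * fderiv ℝ ψ z (Pi.single k 1) + Complex.I * (χ z * fderiv ℝ ψ z (Pi.single k Complex.I))) :=
    fun z => by simp only [WeightedDomain.dzbar]; ring
  simp_rw [l, r]
  rw [integral_const_mul, integral_const_mul, integral_add, integral_add, integral_const_mul,
    integral_const_mul, hv, hv]
  · ring
  · exact hi hχ.contDiff.continuous (hd hψ _) (hs hψ _)
  · exact (hi hχ.contDiff.continuous (hd hψ _) (hs hψ _)).const_mul _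
  · exact hi (hd hχ _) hψ.contDiff.continuous hψ.hasCompactSupport
  · exact (hi (hd hχ _) hψ.contDiff.continuous hψ.hasCompactSupport).const_mul _

variable {Ω} in
theorem IsTest.memLp {ψ : (ι → ℂ) → ℂ} (h : Ω.IsTest ψ) : MemLp ψ 2 Ω.measure := by
  obtain ⟨B, hB⟩ := h.hasCompactSupport.exists_bound_of_continuous h.contDiff.continuous
  exact MemLp.of_bound h.contDiff.continuous.aestronglyMeasurable B
    (Filter.Eventually.of_forall hB)

/-- On smooth compactly supported forms, `∂̄` is given by the usual formula. -/
theorem isWeakDbar_of_isTest (c : Finset ι × Finset ι → (ι → ℂ) → ℂ) (hc : ∀ A, Ω.IsTest (c A)) :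
    Ω.IsWeakDbar (WithLp.toLp 2 fun A => (hc A).memLp.toLp _)
      (WithLp.toLp 2 fun A => ∑ k ∈ A.2, dbarSign k A.1 A.2 •
        ((hc (A.1, A.2.erase k)).dzbar k).memLp.toLp _) := by
  intro I L ψ hψ
  obtain ⟨T, hT⟩ := hψ.exists_clm
  rw [← hT]
  change T (∑ k ∈ L, dbarSign k I L • ((hc (I, L.erase k)).dzbar k).memLp.toLp _) =
    -∑ k ∈ L, dbarSign k I L *
      ∫ z in Ω.carrier, ((hc (I, L.erase k)).memLp.toLp _) z * WeightedDomain.dzbar k ψ z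
  rw [map_sum, ← Finset.sum_neg_distrib]
  have hae : ∀ {a : (ι → ℂ) → ℂ} (ha : Ω.IsTest a) (b : (ι → ℂ) → ℂ),
      ∫ z in Ω.carrier, (ha.memLp.toLp a) z * b z = ∫ z in Ω.carrier, a z * b z := fun ha b => by
    apply integral_congr_ae
    filter_upwards [Ω.absolutelyContinuous_measure.ae_le ha.memLp.coeFn_toLp] with z hz
    rw [hz]
  refine Finset.sum_congr rfl fun k _ => ?_
  rw [map_smul, hT, smul_eq_mul, hae ((hc (I, L.erase k)).dzbar k), hae (hc (I, L.erase k)), hψ.integral_dzbar (hc _)]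
  ring

theorem dbar_dense : Dense (Ω.dbar.domain : Set Ω.L2Forms) := by
  rw [Submodule.dense_iff_topologicalClosure_eq_top, Submodule.topologicalClosure_eq_top_iff,
    Submodule.eq_bot_iff]
  intro h hh
  ext1 B
  rw [PiLp.zero_apply, Lp.eq_zero_iff_ae_eq_zero]
  have key : ∀ᵐ z ∂Ω.measure, Real.exp (-Ω.weight z) • h B z = 0 := by
    refine Ω.ae_eq_zero_of_pairing (Ω.integrable_smul (h B)) fun χ hχ => ?_
    have hconj : Ω.IsTest (fun z => (starRingEnd ℂ) (χ z)) :=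
      ⟨Complex.conjCLE.contDiff.comp hχ.contDiff,
        hχ.hasCompactSupport.comp_left (g := starRingEnd ℂ) (by simp),
        (tsupport_comp_subset (g := starRingEnd ℂ) (by simp) χ).trans hχ.tsupport_subset⟩
    have hzero : Ω.IsTest (fun _ => 0) := ⟨contDiff_const, HasCompactSupport.zero, by
      simp [tsupport]⟩
    have hc : ∀ A, Ω.IsTest (if A = B then fun z => (starRingEnd ℂ) (χ z) else fun _ => 0) :=
      fun A => by split_ifs <;> assumption
    have hm := LinearPMap.mem_domain_of_mem_graph
      ((Ω.mem_dbar_graph).2 (Ω.isWeakDbar_of_isTest _ hc))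
    have := Submodule.inner_right_of_mem_orthogonal hm hh
    rw [PiLp.inner_apply, Finset.sum_eq_single B] at this
    · rw [L2.inner_def] at this
      rw [setIntegral_eq, ← this]
      apply integral_congr_ae
      filter_upwards [(hc B).memLp.coeFn_toLp] with z hz
      rw [hz]
      have he : (Real.exp (Ω.weight z) : ℂ) * (Real.exp (-Ω.weight z) : ℂ) = 1 := by
        rw [← Complex.ofReal_mul, ← Real.exp_add]; simp
      simp only [if_true, Complex.real_smul, RCLike.inner_apply, Complex.conj_conj]
      linear_combination (h B z * χ z) * he
    · intro A _ hA
      have : (hc A).memLp.toLp _ = 0 := by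
        rw [Lp.eq_zero_iff_ae_eq_zero]
        filter_upwards [(hc A).memLp.coeFn_toLp] with z hz
        rw [hz]; simp [hA]
      simp only [this, inner_zero_left]
    · simp
  filter_upwards [key] with z hz
  exact (smul_eq_zero.1 hz).resolve_left (Real.exp_pos _).ne'

theorem dbar_closedDenselyDefined : ClosedDenselyDefined Ω.dbar :=
  ⟨Ω.dbar_isClosed, Ω.dbar_dense⟩

end Dbar

/-! ### Product domains -/

section Split

variable {ι₁ ι₂ : Type*}

/-- The coordinates `(z, w)` of a point of `ℂ^{ι₁} × ℂ^{ι₂}`. -/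
def split (x : (ι₁ ⊕ₗ ι₂) → ℂ) : (ι₁ → ℂ) × (ι₂ → ℂ) :=
  (fun i => x (Sum.inlₗ i), fun j => x (Sum.inrₗ j))

theorem continuous_split : Continuous (split : ((ι₁ ⊕ₗ ι₂) → ℂ) → _) := by
  unfold split; fun_prop

/-- `split` as a measurable equivalence. -/
def splitEquiv : ((ι₁ ⊕ₗ ι₂) → ℂ) ≃ᵐ (ι₁ → ℂ) × (ι₂ → ℂ) :=
  MeasurableEquiv.sumPiEquivProdPi fun _ : ι₁ ⊕ ι₂ => ℂ

theorem measurePreserving_split [Fintype ι₁] [Fintype ι₂] :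
    MeasurePreserving (split : ((ι₁ ⊕ₗ ι₂) → ℂ) → (ι₁ → ℂ) × (ι₂ → ℂ)) volume volume :=
  volume_measurePreserving_sumPiEquivProdPi fun _ : ι₁ ⊕ ι₂ => ℂ

theorem measurableEmbedding_split :
    MeasurableEmbedding (split : ((ι₁ ⊕ₗ ι₂) → ℂ) → (ι₁ → ℂ) × (ι₂ → ℂ)) :=
  (splitEquiv (ι₁ := ι₁) (ι₂ := ι₂)).measurableEmbedding

/-- The inverse of `split`. -/
def join (x : (ι₁ → ℂ) × (ι₂ → ℂ)) : (ι₁ ⊕ₗ ι₂) → ℂ := fun i => Sum.elim x.1 x.2 (ofLex i)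

theorem split_join (x : (ι₁ → ℂ) × (ι₂ → ℂ)) : split (join x) = x := rfl

theorem join_split (x : (ι₁ ⊕ₗ ι₂) → ℂ) : join (split x) = x := by
  funext i
  rcases i with i | i <;> rfl

theorem continuous_join : Continuous (join : (ι₁ → ℂ) × (ι₂ → ℂ) → _) := by
  refine continuous_pi fun i => ?_
  rcases i with i | i
  · exact (continuous_apply i).comp continuous_fst
  · exact (continuous_apply i).comp continuous_snd

end Split

section Product

variable {ι₁ ι₂ : Type*} [Fintype ι₁] [Fintype ι₂]
  (Ω₁ : WeightedDomain ι₁) (Ω₂ : WeightedDomain ι₂)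

/-- The product domain `Ω₁ × Ω₂` with the weight `φ₁ + φ₂`. -/
def prod : WeightedDomain (ι₁ ⊕ₗ ι₂) where
  carrier := split ⁻¹' (Ω₁.carrier ×ˢ Ω₂.carrier)
  isOpen := (Ω₁.isOpen.prod Ω₂.isOpen).preimage continuous_split
  isConnected := by
    have : split ⁻¹' (Ω₁.carrier ×ˢ Ω₂.carrier) = join '' (Ω₁.carrier ×ˢ Ω₂.carrier) := by
      ext x
      constructor
      · exact fun h => ⟨split x, h, join_split x⟩
      · rintro ⟨y, hy, rfl⟩
        rwa [Set.mem_preimage, split_join]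
    rw [this]
    exact (Ω₁.isConnected.prod Ω₂.isConnected).image _ continuous_join.continuousOn
  isBounded := by
    have hK : IsCompact (join '' (closure Ω₁.carrier ×ˢ closure Ω₂.carrier)) :=
      (Ω₁.isCompact_closure.prod Ω₂.isCompact_closure).image continuous_join
    refine hK.isBounded.subset fun x hx => ⟨split x, ?_, join_split x⟩
    exact ⟨subset_closure hx.1, subset_closure hx.2⟩
  weight x := Ω₁.weight (split x).1 + Ω₂.weight (split x).2
  continuousOn_weight := by
    have hm : Set.MapsTo split (closure (split ⁻¹' (Ω₁.carrier ×ˢ Ω₂.carrier)))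
        (closure Ω₁.carrier ×ˢ closure Ω₂.carrier) := by
      intro x hx
      rw [← closure_prod_eq]
      exact map_mem_closure continuous_split hx fun y hy => hy
    exact (Ω₁.continuousOn_weight.comp (continuous_fst.comp continuous_split).continuousOn
      fun x hx => (hm hx).1).add
      (Ω₂.continuousOn_weight.comp (continuous_snd.comp continuous_split).continuousOn
      fun x hx => (hm hx).2)

theorem measurePreserving_split_measure :
    MeasurePreserving split (Ω₁.prod Ω₂).measure (Ω₁.measure.prod Ω₂.measure) := by
  refine ⟨continuous_split.measurable, ?_⟩
  have h0 : Measure.map split (volume.restrict (Ω₁.prod Ω₂).carrier) =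
      (volume.restrict Ω₁.carrier).prod (volume.restrict Ω₂.carrier) := by
    rw [Measure.prod_restrict]
    exact (measurePreserving_split.restrict_preimage
      (Ω₁.isOpen.prod Ω₂.isOpen).measurableSet).map_eq
  rw [measure, measure, measure, prod_withDensity₀ Ω₁.aemeasurable_density Ω₂.aemeasurable_density, ← h0]
  ext s hs
  rw [Measure.map_apply continuous_split.measurable hs, withDensity_apply _ hs,
    withDensity_apply _ (continuous_split.measurable hs),
    measurableEmbedding_split.restrict_map, measurableEmbedding_split.lintegral_map]
  refine lintegral_congr fun x => ?_
  rw [← ENNReal.ofReal_mul (Real.exp_pos _).le, ← Real.exp_add]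
  congr 2
  simp only [prod]
  ring

theorem memLp_mul (a : Lp ℂ 2 Ω₁.measure) (b : Lp ℂ 2 Ω₂.measure) :
    MemLp (fun x => a (split x).1 * b (split x).2) 2 (Ω₁.prod Ω₂).measure := by
  have h : MemLp (fun y : (ι₁ → ℂ) × (ι₂ → ℂ) => a y.1 * b y.2) 2
      (Ω₁.measure.prod Ω₂.measure) := by
    rw [memLp_two_iff_integrable_sq_norm]
    · have := ((memLp_two_iff_integrable_sq_norm (Lp.aestronglyMeasurable a)).1
        (Lp.memLp a)).mul_prod ((memLp_two_iff_integrable_sq_norm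
          (Lp.aestronglyMeasurable b)).1 (Lp.memLp b))
      simpa only [norm_mul, mul_pow] using this
    · exact (Lp.aestronglyMeasurable a).comp_fst.mul (Lp.aestronglyMeasurable b).comp_snd
  exact h.comp_measurePreserving (measurePreserving_split_measure Ω₁ Ω₂)

/-- The function `(z, w) ↦ a(z) b(w)`. -/
def mulLp (a : Lp ℂ 2 Ω₁.measure) (b : Lp ℂ 2 Ω₂.measure) : Lp ℂ 2 (Ω₁.prod Ω₂).measure :=
  (memLp_mul Ω₁ Ω₂ a b).toLp _

/-- The part of a set of indices that belongs to the first factor. -/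
def leftPart (I : Finset (ι₁ ⊕ₗ ι₂)) : Finset ι₁ := Finset.toLeft (α := ι₁) (β := ι₂) I

/-- The part of a set of indices that belongs to the second factor. -/
def rightPart (I : Finset (ι₁ ⊕ₗ ι₂)) : Finset ι₂ := Finset.toRight (α := ι₁) (β := ι₂) I

/-- A set of indices is determined by its two parts. -/
def partsEquiv : Finset (ι₁ ⊕ₗ ι₂) ≃ Finset ι₁ × Finset ι₂ :=
  (Finset.sumEquiv (α := ι₁) (β := ι₂)).toEquiv

theorem mulLp_coeFn (a : Lp ℂ 2 Ω₁.measure) (b : Lp ℂ 2 Ω₂.measure) :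
    mulLp Ω₁ Ω₂ a b =ᵐ[(Ω₁.prod Ω₂).measure] fun x => a (split x).1 * b (split x).2 :=
  (memLp_mul Ω₁ Ω₂ a b).coeFn_toLp

theorem ae_split {p : (ι₁ → ℂ) → Prop} {q : (ι₂ → ℂ) → Prop} (hp : ∀ᵐ z ∂Ω₁.measure, p z)
    (hq : ∀ᵐ w ∂Ω₂.measure, q w) :
    ∀ᵐ x ∂(Ω₁.prod Ω₂).measure, p (split x).1 ∧ q (split x).2 := by
  have h1 := (Measure.quasiMeasurePreserving_fst (μ := Ω₁.measure) (ν := Ω₂.measure)).ae hp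
  have h2 := (Measure.quasiMeasurePreserving_snd (μ := Ω₁.measure) (ν := Ω₂.measure)).ae hq
  exact (measurePreserving_split_measure Ω₁ Ω₂).quasiMeasurePreserving.ae (h1.and h2)

theorem inner_mulLp (a a' : Lp ℂ 2 Ω₁.measure) (b b' : Lp ℂ 2 Ω₂.measure) :
    ⟪mulLp Ω₁ Ω₂ a b, mulLp Ω₁ Ω₂ a' b'⟫_ℂ = ⟪a, a'⟫_ℂ * ⟪b, b'⟫_ℂ := by
  simp only [L2.inner_def]
  rw [← integral_prod_mul, ← (measurePreserving_split_measure Ω₁ Ω₂).integral_comp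
    measurableEmbedding_split]
  apply integral_congr_ae
  filter_upwards [mulLp_coeFn Ω₁ Ω₂ a b, mulLp_coeFn Ω₁ Ω₂ a' b'] with x h h'
  rw [h, h']
  simp only [RCLike.inner_apply, map_mul]
  ring

/-- The form `f ⊗ g = π₁^* f ∧ π₂^* g`. The sign comes from
`dz^{I₁} ∧ dz̄^{J₁} ∧ dw^{I₂} ∧ dw̄^{J₂} = (-1)^{|J₁||I₂|} dz^{I₁} ∧ dw^{I₂} ∧ dz̄^{J₁} ∧ dw̄^{J₂}`. -/
def tensorForm (f : Ω₁.L2Forms) (g : Ω₂.L2Forms) : (Ω₁.prod Ω₂).L2Forms :=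
  WithLp.toLp 2 fun A => ((-1 : ℂ) ^ ((leftPart A.2).card * (rightPart A.1).card)) •
    mulLp Ω₁ Ω₂ (f (leftPart A.1, leftPart A.2)) (g (rightPart A.1, rightPart A.2))

theorem inner_tensorForm (f f' : Ω₁.L2Forms) (g g' : Ω₂.L2Forms) :
    ⟪tensorForm Ω₁ Ω₂ f g, tensorForm Ω₁ Ω₂ f' g'⟫_ℂ = ⟪f, f'⟫_ℂ * ⟪g, g'⟫_ℂ := by
  have h : ⟪tensorForm Ω₁ Ω₂ f g, tensorForm Ω₁ Ω₂ f' g'⟫_ℂ =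
      ∑ A : Finset (ι₁ ⊕ₗ ι₂) × Finset (ι₁ ⊕ₗ ι₂),
        ⟪f (leftPart A.1, leftPart A.2), f' (leftPart A.1, leftPart A.2)⟫_ℂ *
          ⟪g (rightPart A.1, rightPart A.2), g' (rightPart A.1, rightPart A.2)⟫_ℂ := by
    rw [PiLp.inner_apply]
    refine Finset.sum_congr rfl fun A _ => ?_
    simp only [tensorForm, inner_smul_left, inner_smul_right, inner_mulLp, map_pow, map_neg,
      map_one]
    rw [← mul_assoc, ← mul_pow]
    simp
  rw [h, PiLp.inner_apply, PiLp.inner_apply, Finset.sum_mul_sum, ← Finset.sum_product',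
    Finset.univ_product_univ]
  exact Fintype.sum_equiv ((partsEquiv.prodCongr partsEquiv).trans
    (Equiv.prodProdProdComm _ _ _ _)) _ _ fun A => rfl

theorem mulLp_add_left (a a' : Lp ℂ 2 Ω₁.measure) (b : Lp ℂ 2 Ω₂.measure) :
    mulLp Ω₁ Ω₂ (a + a') b = mulLp Ω₁ Ω₂ a b + mulLp Ω₁ Ω₂ a' b := by
  refine Lp.ext ?_
  filter_upwards [mulLp_coeFn Ω₁ Ω₂ (a + a') b, mulLp_coeFn Ω₁ Ω₂ a b, mulLp_coeFn Ω₁ Ω₂ a' b,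
    Lp.coeFn_add (mulLp Ω₁ Ω₂ a b) (mulLp Ω₁ Ω₂ a' b),
    ae_split Ω₁ Ω₂ (Lp.coeFn_add a a') (Filter.Eventually.of_forall fun _ => trivial)]
    with x h1 h2 h3 h4 h5
  rw [h1, h4, Pi.add_apply, h2, h3, h5.1, Pi.add_apply, add_mul]

theorem mulLp_add_right (a : Lp ℂ 2 Ω₁.measure) (b b' : Lp ℂ 2 Ω₂.measure) :
    mulLp Ω₁ Ω₂ a (b + b') = mulLp Ω₁ Ω₂ a b + mulLp Ω₁ Ω₂ a b' := by
  refine Lp.ext ?_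
  filter_upwards [mulLp_coeFn Ω₁ Ω₂ a (b + b'), mulLp_coeFn Ω₁ Ω₂ a b, mulLp_coeFn Ω₁ Ω₂ a b',
    Lp.coeFn_add (mulLp Ω₁ Ω₂ a b) (mulLp Ω₁ Ω₂ a b'),
    ae_split Ω₁ Ω₂ (Filter.Eventually.of_forall fun _ => trivial) (Lp.coeFn_add b b')]
    with x h1 h2 h3 h4 h5
  rw [h1, h4, Pi.add_apply, h2, h3, h5.2, Pi.add_apply, mul_add]

theorem mulLp_smul_left (c : ℂ) (a : Lp ℂ 2 Ω₁.measure) (b : Lp ℂ 2 Ω₂.measure) :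
    mulLp Ω₁ Ω₂ (c • a) b = c • mulLp Ω₁ Ω₂ a b := by
  refine Lp.ext ?_
  filter_upwards [mulLp_coeFn Ω₁ Ω₂ (c • a) b, mulLp_coeFn Ω₁ Ω₂ a b,
    Lp.coeFn_smul c (mulLp Ω₁ Ω₂ a b),
    ae_split Ω₁ Ω₂ (Lp.coeFn_smul c a) (Filter.Eventually.of_forall fun _ => trivial)]
    with x h1 h2 h3 h4
  rw [h1, h3, Pi.smul_apply, h2, h4.1, Pi.smul_apply, smul_mul_assoc]

theorem mulLp_smul_right (c : ℂ) (a : Lp ℂ 2 Ω₁.measure) (b : Lp ℂ 2 Ω₂.measure) :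
    mulLp Ω₁ Ω₂ a (c • b) = c • mulLp Ω₁ Ω₂ a b := by
  refine Lp.ext ?_
  filter_upwards [mulLp_coeFn Ω₁ Ω₂ a (c • b), mulLp_coeFn Ω₁ Ω₂ a b,
    Lp.coeFn_smul c (mulLp Ω₁ Ω₂ a b),
    ae_split Ω₁ Ω₂ (Filter.Eventually.of_forall fun _ => trivial) (Lp.coeFn_smul c b)]
    with x h1 h2 h3 h4
  rw [h1, h3, Pi.smul_apply, h2, h4.2, Pi.smul_apply, mul_smul_comm]

/-- The linear map `x ⊗ₜ y ↦ x ⊗ y` from the algebraic tensor product to forms on the product. -/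
def tensorLinear : Ω₁.L2Forms ⊗[ℂ] Ω₂.L2Forms →ₗ[ℂ] (Ω₁.prod Ω₂).L2Forms :=
  TensorProduct.lift (LinearMap.mk₂ ℂ (tensorForm Ω₁ Ω₂)
    (fun f f' g => by
      ext1 A
      simp [tensorForm, mulLp_add_left])
    (fun c f g => by
      ext1 A
      simp [tensorForm, mulLp_smul_left, smul_comm c])
    (fun f g g' => by
      ext1 A
      simp [tensorForm, mulLp_add_right])
    (fun c f g => by
      ext1 A
      simp [tensorForm, mulLp_smul_right, smul_comm c]))

theorem inner_tensorLinear (x y : Ω₁.L2Forms ⊗[ℂ] Ω₂.L2Forms) :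
    ⟪tensorLinear Ω₁ Ω₂ x, tensorLinear Ω₁ Ω₂ y⟫_ℂ = ⟪x, y⟫_ℂ := by
  induction x with
  | zero => simp
  | add x x' hx hx' => rw [map_add, inner_add_left, inner_add_left, hx, hx']
  | tmul f g =>
    induction y with
    | zero => simp
    | add y y' hy hy' => rw [map_add, inner_add_right, inner_add_right, hy, hy']
    | tmul f' g' =>
      rw [TensorProduct.inner_tmul]
      exact inner_tensorForm Ω₁ Ω₂ f f' g g'

/-- The isometric identification of the Hilbert tensor product (the completion of the algebraic
tensor product) with the `L²` forms on the product domain, determined by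
`f ⊗ₜ g ↦ π₁^* f ∧ π₂^* g`. -/
def hilbertTensor :
    UniformSpace.Completion (Ω₁.L2Forms ⊗[ℂ] Ω₂.L2Forms) →L[ℂ] (Ω₁.prod Ω₂).L2Forms :=
  ((tensorLinear Ω₁ Ω₂).isometryOfInner
    (inner_tensorLinear Ω₁ Ω₂)).toContinuousLinearMap.fromCompletion

/-- The bounded operator `A ⊗̂ B` on forms on the product: the continuous extension of the
algebraic tensor product of `A` and `B`, transported along the unitary `hilbertTensor`, whose
inverse is its adjoint. -/
def tensorOp (A : Ω₁.L2Forms →L[ℂ] Ω₁.L2Forms) (B : Ω₂.L2Forms →L[ℂ] Ω₂.L2Forms) :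
    (Ω₁.prod Ω₂).L2Forms →L[ℂ] (Ω₁.prod Ω₂).L2Forms :=
  hilbertTensor Ω₁ Ω₂ ∘L (TensorProduct.mapL A B).completion ∘L
    ContinuousLinearMap.adjoint (hilbertTensor Ω₁ Ω₂)

theorem tensorOp_tensorForm (A : Ω₁.L2Forms →L[ℂ] Ω₁.L2Forms) (B : Ω₂.L2Forms →L[ℂ] Ω₂.L2Forms)
    (f : Ω₁.L2Forms) (g : Ω₂.L2Forms) :
    tensorOp Ω₁ Ω₂ A B (tensorForm Ω₁ Ω₂ f g) = tensorForm Ω₁ Ω₂ (A f) (B g) := by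
  have hU : ∀ x : Ω₁.L2Forms ⊗[ℂ] Ω₂.L2Forms,
      hilbertTensor Ω₁ Ω₂ (x : UniformSpace.Completion _) = tensorLinear Ω₁ Ω₂ x := fun x =>
    ContinuousLinearMap.fromCompletion_apply_coe _ x
  have hadj : ∀ y, ContinuousLinearMap.adjoint (hilbertTensor Ω₁ Ω₂) (hilbertTensor Ω₁ Ω₂ y) = y := by
    have hiso : Isometry (hilbertTensor Ω₁ Ω₂) := by
      refine AddMonoidHomClass.isometry_of_norm _ fun y => ?_
      induction y using UniformSpace.Completion.induction_on with
      | hp => exact isClosed_eq (by fun_prop) (by fun_prop)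
      | ih x =>
        rw [hU, UniformSpace.Completion.norm_coe]
        exact ((tensorLinear Ω₁ Ω₂).isometryOfInner (inner_tensorLinear Ω₁ Ω₂)).norm_map x
    have := (ContinuousLinearMap.isometry_iff_adjoint_comp_self _).1 hiso
    exact fun y => congrArg (fun T => T y) this
  have h1 : tensorForm Ω₁ Ω₂ f g =
      hilbertTensor Ω₁ Ω₂ ((f ⊗ₜ[ℂ] g : Ω₁.L2Forms ⊗[ℂ] Ω₂.L2Forms) : UniformSpace.Completion _) :=
    (hU (f ⊗ₜ[ℂ] g)).symm
  rw [tensorOp, ContinuousLinearMap.comp_apply, ContinuousLinearMap.comp_apply, h1, hadj,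
    ContinuousLinearMap.completion_apply_coe, hU]
  rfl

end Product

section Solution

/-- `∂̄` has closed range in `L²` forms. As `∂̄` maps bidegree `(p, q)` to `(p, q + 1)` and there are
finitely many bidegrees, this means closed range in each degree. -/
def HasClosedRange {ι : Type*} [Fintype ι] [LinearOrder ι] (Ω : WeightedDomain ι) : Prop :=
  IsClosed (rangeOp Ω.dbar : Set Ω.L2Forms)

/-- The harmonic projection `P`. -/
def harmonicP {ι : Type*} [Fintype ι] [LinearOrder ι] (Ω : WeightedDomain ι) :
    Ω.L2Forms →L[ℂ] Ω.L2Forms :=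
  harmonicProjection Ω.dbar_closedDenselyDefined

/-- The canonical solution operator `K`. -/
def canonicalK {ι : Type*} [Fintype ι] [LinearOrder ι] {Ω : WeightedDomain ι}
    (h : Ω.HasClosedRange) : Ω.L2Forms →L[ℂ] Ω.L2Forms :=
  canonicalSolution Ω.dbar_closedDenselyDefined h

/-- The operator `S = K₁ ⊗̂ I₂ + σ₁ P₁ ⊗̂ K₂` on the product domain. -/
def solutionS {ι₁ ι₂ : Type*} [Fintype ι₁] [LinearOrder ι₁] [Fintype ι₂] [LinearOrder ι₂]
    {Ω₁ : WeightedDomain ι₁} {Ω₂ : WeightedDomain ι₂} (h₁ : Ω₁.HasClosedRange)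
    (h₂ : Ω₂.HasClosedRange) : (Ω₁.prod Ω₂).L2Forms →L[ℂ] (Ω₁.prod Ω₂).L2Forms :=
  tensorOp Ω₁ Ω₂ (canonicalK h₁) (ContinuousLinearMap.id ℂ _) +
    tensorOp Ω₁ Ω₂ (Ω₁.sigma ∘L Ω₁.harmonicP) (canonicalK h₂)

end Solution

end WeightedDomain

end

/-!
The proof rests on two facts. The first is the homotopy formula `∂̄ S + S ∂̄ = 1 - P₁ ⊗ P₂` on the
domain of `∂̄` (`solutionS_graph`). Formally it is a computation with `∂̄ = ∂̄₁ ⊗ 1 + σ₁ ⊗ ∂̄₂`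
and the identities `∂̄ⱼ Kⱼ + Kⱼ ∂̄ⱼ = 1 - Pⱼ`, where `Kⱼ` is odd and `Pⱼ` is even with respect to
`σⱼ`. It shows that the range of `∂̄` is the intersection of the kernels of `∂̄` and of the
bounded operator `P₁ ⊗ P₂`, hence closed (`rangeOp_prod_eq`); then `K K† + K† K` is the Neumann
operator (`isNeumannOperator_neumann`).

The formula cannot be checked directly on the domain of `∂̄`, for which the algebraic tensor
product of the two domains is not obviously a core. The argument therefore passes to adjoints. The
weak operator `∂̄` is by definition the adjoint of its formal adjoint on test forms, and a weak
equation on a product domain has to be tested only on products `a(z) b(w)` of test functions: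
integrating such equations over the translates of a product mollifier gives the equation for the
mollification of any test function (`weak_equation_of_mulFun`). Thus `∂̄` is the adjoint of
`∂̄₁† ⊗ 1 + σ₁ ⊗ ∂̄₂†` on the algebraic tensor product of the domains of `∂̄₁†` and `∂̄₂†`
(`tensorForm_adjoint_graph`, `dbar_prod_graph_of_adjoint`), and it suffices to compute
`S† ∂̄† + ∂̄† S†` on product forms `x ⊗ y`.

The second fact is that `S f ⟂ ker ∂̄` for `(p, 1)`-forms `f` (`solutionS_mem`). If `k` is
`∂̄`-closed, its contraction with an element of `ker ∂̄₂†` is `∂̄₁`-closed, hence orthogonal to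
the range of `K₁`, and symmetrically in the other factor. The second summand of `S` is covered
because the range of `P₁` lies in `ker ∂̄₁†`. In the first one, `K₁` annihilates the bidegrees
`(·, 0)`, so that on `(p, 1)`-forms only components of bidegree `(·, 0)` in the second factor
contribute, and these lie in `ker ∂̄₂†`.

For closed `(p, 1)`-forms `f`, the form `S f` is then the minimal solution of
`∂̄ u = f - (P₁ ⊗ P₂) f`, and `(P₁ ⊗ P₂) f` is orthogonal to the range of `∂̄`; hence `S f = K f`.
-/

noncomputable section

/-! ### The homotopy formula for a closed operator with closed range -/

section HilbertComplex

variable {H : Type*} [NormedAddCommGroup H] [InnerProductSpace ℂ H] {T : H →ₗ.[ℂ] H}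

theorem mem_rangeOp {g : H} : g ∈ rangeOp T ↔ ∃ u, (u, g) ∈ T.graph := by
  constructor
  · rintro ⟨u, rfl⟩
    exact ⟨u, T.mem_graph u⟩
  · rintro ⟨u, h⟩
    obtain ⟨y, -, h2⟩ := (LinearPMap.mem_graph_iff T).1 h
    exact ⟨y, h2⟩

theorem eq_of_graph_of_mem {u u' g : H} (h : (u, g) ∈ T.graph) (h' : (u', g) ∈ T.graph)
    (hu : u ∈ (kerOp T)ᗮ) (hu' : u' ∈ (kerOp T)ᗮ) : u = u' := by
  have h1 : u - u' ∈ kerOp T := by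
    rw [mem_kerOp]; simpa using T.graph.sub_mem h h'
  exact sub_eq_zero.1 (inner_self_eq_zero.1
    (Submodule.inner_right_of_mem_orthogonal h1 (Submodule.sub_mem _ hu hu')))

theorem grading_mem_kerOp {s : H →L[ℂ] H}
    (hg : ∀ u g, (u, g) ∈ T.graph → (s u, -s g) ∈ T.graph) {u : H} (hu : u ∈ kerOp T) :
    s u ∈ kerOp T := by
  rw [mem_kerOp] at hu ⊢
  simpa using hg _ _ hu

theorem grading_mem_kerOp_orthogonal {s : H →L[ℂ] H}
    (hs : ∀ u v, ⟪s u, v⟫_ℂ = ⟪u, s v⟫_ℂ)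
    (hg : ∀ u g, (u, g) ∈ T.graph → (s u, -s g) ∈ T.graph) {u : H}
    (hu : u ∈ (kerOp T)ᗮ) : s u ∈ (kerOp T)ᗮ := by
  rw [Submodule.mem_orthogonal'] at hu ⊢
  intro v hv
  rw [hs]
  exact hu _ (grading_mem_kerOp hg hv)

variable [CompleteSpace H]

namespace ClosedDenselyDefined

/-- The defining relation of the adjoint, as a statement about graphs. -/
theorem mem_adjoint_graph_iff (hT : ClosedDenselyDefined T) {x v : H} :
    (x, v) ∈ T†.graph ↔ ∀ u g, (u, g) ∈ T.graph → ⟪x, g⟫_ℂ = ⟪v, u⟫_ℂ := by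
  rw [LinearPMap.adjoint_graph_eq_graph_adjoint hT.dense, Submodule.mem_adjoint_iff]
  refine forall₃_congr fun u g _ => ?_
  rw [sub_eq_zero, ← inner_conj_symm x g, ← inner_conj_symm v u, (starRingEnd ℂ).injective.eq_iff]

theorem mem_kerOp_adjoint_iff (hT : ClosedDenselyDefined T) {x : H} :
    x ∈ kerOp T† ↔ x ∈ (rangeOp T)ᗮ := by
  rw [mem_kerOp, hT.mem_adjoint_graph_iff, Submodule.mem_orthogonal']
  simp only [inner_zero_left]
  exact ⟨fun h g hg => (mem_rangeOp.1 hg).elim fun u hu => h u g hu,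
    fun h u g hu => h g (mem_rangeOp.2 ⟨u, hu⟩)⟩

/-- The orthogonal projection onto the kernel of a closed operator. -/
def kerProjection (hT : ClosedDenselyDefined T) : H →L[ℂ] H :=
  haveI : CompleteSpace (kerOp T) :=
    completeSpace_coe_iff_isComplete.2 (isClosed_kerOp hT.isClosed).isComplete
  (kerOp T).starProjection

/-- The orthogonal projection onto the closed range of an operator. The unnamed argument is there for
dot notation only. -/
def rangeProjection (_ : ClosedDenselyDefined T) (hR : IsClosed (rangeOp T : Set H)) : H →L[ℂ] H :=
  haveI : CompleteSpace (rangeOp T) := completeSpace_coe_iff_isComplete.2 hR.isComplete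
  (rangeOp T).starProjection

variable (hT : ClosedDenselyDefined T) (hR : IsClosed (rangeOp T : Set H))

theorem kerProjection_mem (u : H) : hT.kerProjection u ∈ kerOp T := by
  have : CompleteSpace (kerOp T) :=
    completeSpace_coe_iff_isComplete.2 (isClosed_kerOp hT.isClosed).isComplete
  exact (kerOp T).starProjection_apply_mem u

theorem sub_kerProjection_mem (u : H) : u - hT.kerProjection u ∈ (kerOp T)ᗮ := by
  have : CompleteSpace (kerOp T) :=
    completeSpace_coe_iff_isComplete.2 (isClosed_kerOp hT.isClosed).isComplete
  exact (kerOp T).sub_starProjection_mem_orthogonal u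

theorem rangeProjection_mem (u : H) : hT.rangeProjection hR u ∈ rangeOp T := by
  have : CompleteSpace (rangeOp T) := completeSpace_coe_iff_isComplete.2 hR.isComplete
  exact (rangeOp T).starProjection_apply_mem u

theorem sub_rangeProjection_mem (u : H) : u - hT.rangeProjection hR u ∈ (rangeOp T)ᗮ := by
  have : CompleteSpace (rangeOp T) := completeSpace_coe_iff_isComplete.2 hR.isComplete
  exact (rangeOp T).sub_starProjection_mem_orthogonal u

theorem inner_kerProjection_left (u v : H) :
    ⟪hT.kerProjection u, v⟫_ℂ = ⟪u, hT.kerProjection v⟫_ℂ := by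
  have : CompleteSpace (kerOp T) :=
    completeSpace_coe_iff_isComplete.2 (isClosed_kerOp hT.isClosed).isComplete
  exact (kerOp T).inner_starProjection_left_eq_right u v

theorem inner_rangeProjection_left (u v : H) :
    ⟪hT.rangeProjection hR u, v⟫_ℂ = ⟪u, hT.rangeProjection hR v⟫_ℂ := by
  have : CompleteSpace (rangeOp T) := completeSpace_coe_iff_isComplete.2 hR.isComplete
  exact (rangeOp T).inner_starProjection_left_eq_right u v

theorem rangeProjection_eq_self {g : H} (hg : g ∈ rangeOp T) : hT.rangeProjection hR g = g := by
  have : CompleteSpace (rangeOp T) := completeSpace_coe_iff_isComplete.2 hR.isComplete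
  exact Submodule.starProjection_eq_self_iff.2 hg

/-- `T K` is the orthogonal projection onto the range of `T`. -/
theorem canonicalSolution_graph (f : H) :
    (canonicalSolution hT hR f, hT.rangeProjection hR f) ∈ T.graph := by
  have : CompleteSpace (rangeOp T) := completeSpace_coe_iff_isComplete.2 hR.isComplete
  exact (minimalSolution_spec hT.isClosed ((rangeOp T).orthogonalProjectionOnto f)).1

theorem canonicalSolution_mem (f : H) : canonicalSolution hT hR f ∈ (kerOp T)ᗮ := by
  have : CompleteSpace (rangeOp T) := completeSpace_coe_iff_isComplete.2 hR.isComplete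
  exact (minimalSolution_spec hT.isClosed ((rangeOp T).orthogonalProjectionOnto f)).2

theorem canonicalSolution_eq {u g : H} (h : (u, g) ∈ T.graph) (hu : u ∈ (kerOp T)ᗮ) :
    canonicalSolution hT hR g = u := by
  have h1 := hT.canonicalSolution_graph hR g
  rw [hT.rangeProjection_eq_self hR (mem_rangeOp.2 ⟨u, h⟩)] at h1
  exact eq_of_graph_of_mem h1 h (hT.canonicalSolution_mem hR g) hu

/-- `K T = 1 - Z` on the domain of `T`, where `Z` is the orthogonal projection onto `ker T`. -/
theorem canonicalSolution_of_graph {u g : H} (h : (u, g) ∈ T.graph) :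
    canonicalSolution hT hR g = u - hT.kerProjection u := by
  refine hT.canonicalSolution_eq hR ?_ (hT.sub_kerProjection_mem u)
  simpa using T.graph.sub_mem h (mem_kerOp.1 (hT.kerProjection_mem u))

theorem canonicalSolution_eq_zero {f : H} (hf : f ∈ (rangeOp T)ᗮ) :
    canonicalSolution hT hR f = 0 := by
  have : CompleteSpace (rangeOp T) := completeSpace_coe_iff_isComplete.2 hR.isComplete
  have h0 : (rangeOp T).orthogonalProjectionOnto f = 0 :=
    Submodule.orthogonalProjectionOnto_eq_zero_iff.2 hf
  simp only [canonicalSolution, ContinuousLinearMap.comp_apply, h0, map_zero]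

/-- `T† K† = 1 - Z`, where `Z` is the orthogonal projection onto `ker T`. -/
theorem adjoint_canonicalSolution_graph (v : H) :
    ((canonicalSolution hT hR).adjoint v, v - hT.kerProjection v) ∈ T†.graph := by
  rw [hT.mem_adjoint_graph_iff]
  intro u g h
  rw [ContinuousLinearMap.adjoint_inner_left, hT.canonicalSolution_of_graph hR h, inner_sub_left,
    inner_sub_right, inner_kerProjection_left]

/-- `K† T†` is the orthogonal projection onto the range of `T`, on the domain of `T†`. -/
theorem adjoint_canonicalSolution_of_graph {u v : H} (h : (u, v) ∈ T†.graph) :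
    (canonicalSolution hT hR).adjoint v = hT.rangeProjection hR u := by
  refine ext_inner_right ℂ fun f => ?_
  rw [ContinuousLinearMap.adjoint_inner_left, inner_rangeProjection_left]
  exact (hT.mem_adjoint_graph_iff.1 h _ _ (hT.canonicalSolution_graph hR f)).symm

variable (h2 : rangeOp T ≤ kerOp T)

include h2 in
/-- The Hodge decomposition: the harmonic projection is the difference of the projections onto the
kernel and onto the range. -/
theorem harmonicProjection_eq (f : H) :
    harmonicProjection hT f = hT.kerProjection f - hT.rangeProjection hR f := by
  have : CompleteSpace (harmonicSpace T) :=
    completeSpace_coe_iff_isComplete.2 (isClosed_harmonicSpace hT).isComplete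
  refine Submodule.eq_starProjection_of_mem_orthogonal (K := harmonicSpace T) ⟨?_, ?_⟩ ?_
  · exact Submodule.sub_mem _ (hT.kerProjection_mem f) (h2 (hT.rangeProjection_mem hR f))
  · rw [SetLike.mem_coe, hT.mem_kerOp_adjoint_iff]
    have h1 : f - hT.kerProjection f ∈ (rangeOp T)ᗮ :=
      Submodule.orthogonal_le h2 (hT.sub_kerProjection_mem f)
    have := Submodule.sub_mem _ (hT.sub_rangeProjection_mem hR f) h1
    simpa using this
  · have h1 : f - hT.kerProjection f ∈ (harmonicSpace T)ᗮ :=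
      Submodule.orthogonal_le inf_le_left (hT.sub_kerProjection_mem f)
    have h3 : hT.rangeProjection hR f ∈ (harmonicSpace T)ᗮ := by
      rw [Submodule.mem_orthogonal']
      intro h hh
      exact Submodule.inner_right_of_mem_orthogonal (hT.rangeProjection_mem hR f)
        (hT.mem_kerOp_adjoint_iff.1 hh.2)
    have := Submodule.add_mem _ h1 h3
    convert this using 1
    abel

theorem harmonicProjection_mem (f : H) : harmonicProjection hT f ∈ harmonicSpace T := by
  have : CompleteSpace (harmonicSpace T) :=
    completeSpace_coe_iff_isComplete.2 (isClosed_harmonicSpace hT).isComplete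
  exact (harmonicSpace T).starProjection_apply_mem f

theorem inner_harmonicProjection_left (u v : H) :
    ⟪harmonicProjection hT u, v⟫_ℂ = ⟪u, harmonicProjection hT v⟫_ℂ := by
  have : CompleteSpace (harmonicSpace T) :=
    completeSpace_coe_iff_isComplete.2 (isClosed_harmonicSpace hT).isComplete
  exact (harmonicSpace T).inner_starProjection_left_eq_right u v

/-- The harmonic projection annihilates the range of `T†`. -/
theorem harmonicProjection_of_adjoint_graph {u v : H} (h : (u, v) ∈ T†.graph) :
    harmonicProjection hT v = 0 := by
  refine ext_inner_right ℂ fun f => ?_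
  rw [inner_harmonicProjection_left, inner_zero_left,
    ← hT.mem_adjoint_graph_iff.1 h _ 0 (mem_kerOp.1 (hT.harmonicProjection_mem f).1),
    inner_zero_right]

/-! ### The Neumann operator -/

/-- The operator `K K† + K† K`, which turns out to be the Neumann operator. -/
def neumann : H →L[ℂ] H :=
  canonicalSolution hT hR ∘L (canonicalSolution hT hR).adjoint +
    (canonicalSolution hT hR).adjoint ∘L canonicalSolution hT hR

theorem neumann_apply (f : H) : hT.neumann hR f =
    canonicalSolution hT hR ((canonicalSolution hT hR).adjoint f) +
      (canonicalSolution hT hR).adjoint (canonicalSolution hT hR f) := rfl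

theorem rangeProjection_adjoint_canonicalSolution (f : H) :
    hT.rangeProjection hR ((canonicalSolution hT hR).adjoint f) =
      (canonicalSolution hT hR).adjoint f := by
  rw [← hT.adjoint_canonicalSolution_of_graph hR (hT.adjoint_canonicalSolution_graph hR f), map_sub,
    sub_eq_self]
  refine ext_inner_right ℂ fun g => ?_
  rw [ContinuousLinearMap.adjoint_inner_left, inner_zero_left]
  exact Submodule.inner_right_of_mem_orthogonal (hT.kerProjection_mem f)
    (hT.canonicalSolution_mem hR g)

theorem kerProjection_canonicalSolution (f : H) :
    hT.kerProjection (canonicalSolution hT hR f) = 0 := by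
  refine ext_inner_right ℂ fun g => ?_
  rw [inner_kerProjection_left, inner_zero_left]
  exact Submodule.inner_left_of_mem_orthogonal (hT.kerProjection_mem g)
    (hT.canonicalSolution_mem hR f)

include h2 in
theorem canonicalSolution_mem_kerOp_adjoint (f : H) : canonicalSolution hT hR f ∈ kerOp T† :=
  hT.mem_kerOp_adjoint_iff.2 (Submodule.orthogonal_le h2 (hT.canonicalSolution_mem hR f))

include h2 in
/-- `T† N = K`. -/
theorem neumann_adjoint_graph (f : H) :
    (hT.neumann hR f, canonicalSolution hT hR f) ∈ T†.graph := by
  have h := hT.adjoint_canonicalSolution_graph hR (canonicalSolution hT hR f)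
  rw [kerProjection_canonicalSolution, sub_zero] at h
  have := T†.graph.add_mem
    (mem_kerOp.1 (hT.canonicalSolution_mem_kerOp_adjoint hR h2
      ((canonicalSolution hT hR).adjoint f))) h
  simpa [neumann_apply] using this

include h2 in
/-- `T N = K†`. -/
theorem neumann_graph (f : H) :
    (hT.neumann hR f, (canonicalSolution hT hR).adjoint f) ∈ T.graph := by
  have h := hT.canonicalSolution_graph hR ((canonicalSolution hT hR).adjoint f)
  rw [rangeProjection_adjoint_canonicalSolution] at h
  have h3 : (canonicalSolution hT hR).adjoint (canonicalSolution hT hR f) ∈ kerOp T := by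
    rw [← rangeProjection_adjoint_canonicalSolution]
    exact h2 (hT.rangeProjection_mem hR _)
  simpa [neumann_apply] using T.graph.add_mem h (mem_kerOp.1 h3)

include h2 in
theorem isNeumannOperator_neumann : IsNeumannOperator hT (hT.neumann hR) := by
  intro f
  refine ⟨⟨_, _, _, _, hT.neumann_adjoint_graph hR h2 f, hT.canonicalSolution_graph hR f,
    hT.neumann_graph hR h2 f, hT.adjoint_canonicalSolution_graph hR f, ?_⟩, ?_⟩
  · rw [hT.harmonicProjection_eq hR h2]
    abel
  · refine Submodule.add_mem _
      (Submodule.orthogonal_le inf_le_left (hT.canonicalSolution_mem hR _)) ?_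
    rw [Submodule.mem_orthogonal]
    intro u hu
    have := rangeProjection_mem hT hR
      ((canonicalSolution hT hR).adjoint (canonicalSolution hT hR f))
    rw [rangeProjection_adjoint_canonicalSolution] at this
    exact Submodule.inner_left_of_mem_orthogonal this (hT.mem_kerOp_adjoint_iff.1 hu.2)

/-! ### Grading operators -/

section Grading

variable {s : H →L[ℂ] H} (hs : ∀ u v, ⟪s u, v⟫_ℂ = ⟪u, s v⟫_ℂ)
  (hg : ∀ u g, (u, g) ∈ T.graph → (s u, -s g) ∈ T.graph)

include hT hs hg in
theorem grading_adjoint_graph {x v : H} (h : (x, v) ∈ T†.graph) : (s x, -s v) ∈ T†.graph := by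
  rw [hT.mem_adjoint_graph_iff] at h ⊢
  intro u g hu
  have := h _ _ (hg u g hu)
  rw [inner_neg_right] at this
  rw [inner_neg_left, hs, hs, ← this, neg_neg]

include hs hg in
/-- The canonical solution operator is odd. -/
theorem canonicalSolution_grading (f : H) :
    canonicalSolution hT hR (s f) = -s (canonicalSolution hT hR f) := by
  have h1 := hg _ _ (hT.canonicalSolution_graph hR f)
  have h3 : (-s (canonicalSolution hT hR f), s (hT.rangeProjection hR f)) ∈ T.graph := by
    simpa using T.graph.neg_mem h1
  have h4 : canonicalSolution hT hR (s (f - hT.rangeProjection hR f)) = 0 := by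
    refine hT.canonicalSolution_eq_zero hR ?_
    rw [← hT.mem_kerOp_adjoint_iff]
    have h5 := hT.mem_kerOp_adjoint_iff.2 (hT.sub_rangeProjection_mem hR f)
    rw [mem_kerOp] at h5 ⊢
    simpa using hT.grading_adjoint_graph hs hg h5
  rw [map_sub, map_sub, sub_eq_zero] at h4
  rw [h4]
  exact hT.canonicalSolution_eq hR h3 (Submodule.neg_mem _
    (grading_mem_kerOp_orthogonal hs hg (hT.canonicalSolution_mem hR f)))

include hs hg in
theorem adjoint_canonicalSolution_grading (f : H) :
    (canonicalSolution hT hR).adjoint (s f) = -s ((canonicalSolution hT hR).adjoint f) := by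
  refine ext_inner_right ℂ fun g => ?_
  rw [ContinuousLinearMap.adjoint_inner_left, hs, inner_neg_left, hs,
    ContinuousLinearMap.adjoint_inner_left, hT.canonicalSolution_grading hR hs hg,
    inner_neg_right, neg_neg]

include hs hg in
/-- The harmonic projection is even. -/
theorem harmonicProjection_grading (f : H) :
    harmonicProjection hT (s f) = s (harmonicProjection hT f) := by
  have : CompleteSpace (harmonicSpace T) :=
    completeSpace_coe_iff_isComplete.2 (isClosed_harmonicSpace hT).isComplete
  have hmem : ∀ u ∈ harmonicSpace T, s u ∈ harmonicSpace T := fun u hu => by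
    refine ⟨grading_mem_kerOp hg hu.1, ?_⟩
    have h5 := hu.2
    rw [SetLike.mem_coe, mem_kerOp] at h5 ⊢
    simpa using hT.grading_adjoint_graph hs hg h5
  refine (Submodule.eq_starProjection_of_mem_orthogonal (K := harmonicSpace T)
    (hmem _ (hT.harmonicProjection_mem f)) ?_).symm ▸ rfl
  rw [← map_sub, Submodule.mem_orthogonal']
  intro u hu
  rw [hs]
  exact Submodule.inner_left_of_mem_orthogonal (hmem u hu)
    ((harmonicSpace T).sub_starProjection_mem_orthogonal f)

end Grading

end ClosedDenselyDefined

end HilbertComplex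

namespace WeightedDomain

/-! ### `∂̄` on a single domain -/

section Grading

variable {ι : Type*} [Fintype ι] (Ω : WeightedDomain ι)

theorem inner_sigma_left (u v : Ω.L2Forms) : ⟪Ω.sigma u, v⟫_ℂ = ⟪u, Ω.sigma v⟫_ℂ := by
  simp only [PiLp.inner_apply, sigma_apply, inner_smul_left, inner_smul_right, map_pow, map_neg,
    map_one]

theorem sigma_sigma (u : Ω.L2Forms) : Ω.sigma (Ω.sigma u) = u := by
  ext1 A
  rw [sigma_apply, sigma_apply, smul_smul, ← mul_pow]
  simp

/-- The form `a dz^I ∧ dz̄^J` with a single coefficient, where `A = (I, J)`. -/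
def singleForm [DecidableEq ι] (A : Finset ι × Finset ι) (a : Lp ℂ 2 Ω.measure) : Ω.L2Forms :=
  WithLp.toLp 2 (Pi.single A a)

theorem singleForm_apply [DecidableEq ι] (A B : Finset ι × Finset ι) (a : Lp ℂ 2 Ω.measure) :
    Ω.singleForm A a B = if B = A then a else 0 := by
  simp [singleForm]

theorem inner_singleForm [DecidableEq ι] (A : Finset ι × Finset ι) (a : Lp ℂ 2 Ω.measure)
    (f : Ω.L2Forms) : ⟪Ω.singleForm A a, f⟫_ℂ = ⟪a, f A⟫_ℂ := by
  rw [PiLp.inner_apply, Finset.sum_eq_single A]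
  · simp [singleForm_apply]
  · intro B _ hB
    simp [singleForm_apply, hB]
  · simp

theorem sigma_singleForm [DecidableEq ι] (A : Finset ι × Finset ι) (a : Lp ℂ 2 Ω.measure) :
    Ω.sigma (Ω.singleForm A a) = (-1 : ℂ) ^ (A.1.card + A.2.card) • Ω.singleForm A a := by
  ext1 B
  rw [sigma_apply, PiLp.smul_apply, singleForm_apply]
  split_ifs with h
  · rw [h]
  · simp

/-- The projection onto the forms of bidegree `(·, 0)`. -/
def degreeZero [DecidableEq ι] : Ω.L2Forms →L[ℂ] Ω.L2Forms :=
  (PiLp.continuousLinearEquiv 2 ℂ (fun _ : Finset ι × Finset ι => Lp ℂ 2 Ω.measure)).symm ∘L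
    ContinuousLinearMap.pi fun A => (if A.2 = ∅ then (1 : ℂ) else 0) •
      PiLp.proj 2 (fun _ : Finset ι × Finset ι => Lp ℂ 2 Ω.measure) A

theorem degreeZero_apply [DecidableEq ι] (f : Ω.L2Forms) (A : Finset ι × Finset ι) :
    Ω.degreeZero f A = if A.2 = ∅ then f A else 0 := by
  trans (if A.2 = ∅ then (1 : ℂ) else 0) • f A
  · rfl
  · split_ifs <;> simp

theorem inner_degreeZero_left [DecidableEq ι] (u v : Ω.L2Forms) :
    ⟪Ω.degreeZero u, v⟫_ℂ = ⟪u, Ω.degreeZero v⟫_ℂ := by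
  simp only [PiLp.inner_apply, degreeZero_apply]
  refine Finset.sum_congr rfl fun A _ => ?_
  split_ifs <;> simp

end Grading

section Dbar

variable {ι : Type*} [Fintype ι] [LinearOrder ι] {Ω : WeightedDomain ι}

omit [Fintype ι] in
theorem conj_dbarSign (k : ι) (I L : Finset ι) :
    (starRingEnd ℂ) (dbarSign k I L) = dbarSign k I L := by
  simp [dbarSign]

omit [LinearOrder ι] in
/-- The element of the weighted `L²` space that represents the Lebesgue pairing with a test
function. -/
def IsTest.lp {ψ : (ι → ℂ) → ℂ} (h : Ω.IsTest ψ) : Lp ℂ 2 Ω.measure :=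
  (Ω.memLp_test h.contDiff.continuous h.hasCompactSupport).toLp _

omit [LinearOrder ι] in
theorem IsTest.setIntegral_mul {ψ : (ι → ℂ) → ℂ} (h : Ω.IsTest ψ) (f : Lp ℂ 2 Ω.measure) :
    ∫ z in Ω.carrier, f z * ψ z = ⟪h.lp, f⟫_ℂ :=
  Ω.setIntegral_mul_eq_inner h.contDiff.continuous h.hasCompactSupport f

/-- The smooth compactly supported form with a single coefficient, in index `(I, L)`. -/
def testForm (I L : Finset ι) {ψ : (ι → ℂ) → ℂ} (h : Ω.IsTest ψ) : Ω.L2Forms :=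
  Ω.singleForm (I, L) h.lp

/-- The formal adjoint of `∂̄`, applied to `testForm I L h`. -/
def testFormAdjoint (I L : Finset ι) {ψ : (ι → ℂ) → ℂ} (h : Ω.IsTest ψ) : Ω.L2Forms :=
  -∑ k ∈ L, dbarSign k I L • Ω.singleForm (I, L.erase k) (h.dzbar k).lp

theorem inner_testForm (I L : Finset ι) {ψ : (ι → ℂ) → ℂ} (h : Ω.IsTest ψ) (g : Ω.L2Forms) :
    ⟪testForm I L h, g⟫_ℂ = ∫ z in Ω.carrier, g (I, L) z * ψ z := by
  rw [h.setIntegral_mul, testForm, inner_singleForm]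

theorem inner_testFormAdjoint (I L : Finset ι) {ψ : (ι → ℂ) → ℂ} (h : Ω.IsTest ψ)
    (f : Ω.L2Forms) : ⟪testFormAdjoint I L h, f⟫_ℂ =
      -∑ k ∈ L, dbarSign k I L *
        ∫ z in Ω.carrier, f (I, L.erase k) z * WeightedDomain.dzbar k ψ z := by
  rw [testFormAdjoint, inner_neg_left, sum_inner]
  congr 1
  refine Finset.sum_congr rfl fun k _ => ?_
  rw [inner_smul_left, conj_dbarSign, inner_singleForm, (h.dzbar k).setIntegral_mul]

/-- `∂̄` is the Hilbert space adjoint of the formal adjoint on test forms. -/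
theorem mem_dbar_graph_iff_inner {f g : Ω.L2Forms} : (f, g) ∈ Ω.dbar.graph ↔
    ∀ (I L : Finset ι) (ψ : (ι → ℂ) → ℂ) (h : Ω.IsTest ψ),
      ⟪testForm I L h, g⟫_ℂ = ⟪testFormAdjoint I L h, f⟫_ℂ := by
  rw [mem_dbar_graph]
  refine forall₄_congr fun I L ψ h => ?_
  rw [inner_testForm, inner_testFormAdjoint]

theorem testForm_graph (I L : Finset ι) {ψ : (ι → ℂ) → ℂ} (h : Ω.IsTest ψ) :
    (testForm I L h, testFormAdjoint I L h) ∈ Ω.dbar†.graph := by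
  rw [Ω.dbar_closedDenselyDefined.mem_adjoint_graph_iff]
  exact fun u g hu => mem_dbar_graph_iff_inner.1 hu I L ψ h

theorem dzbar_comm {ψ : (ι → ℂ) → ℂ} (h : ContDiff ℝ ∞ ψ) (j k : ι) :
    dzbar j (dzbar k ψ) = dzbar k (dzbar j ψ) := by
  have h1 : ∀ v, Differentiable ℝ (fun z => fderiv ℝ ψ z v) := fun v =>
    ((h.fderiv_right (m := ∞) (by simp)).clm_apply contDiff_const).differentiable (by simp)
  have h2 : ∀ v w z, fderiv ℝ (fun z => fderiv ℝ ψ z v) z w = fderiv ℝ (fderiv ℝ ψ) z w v := by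
    intro v w z
    rw [fderiv_clm_apply ((h.fderiv_right (m := ∞) (by simp)).differentiable (by simp) z)
      (differentiableAt_const v)]
    simp
  have h3 : ∀ (k : ι) (z w : ι → ℂ), fderiv ℝ (dzbar k ψ) z w =
      (1 / 2) * (fderiv ℝ (fderiv ℝ ψ) z w (Pi.single k 1) +
        Complex.I * fderiv ℝ (fderiv ℝ ψ) z w (Pi.single k Complex.I)) := by
    intro k z w
    rw [← h2, ← h2]
    have hd : HasFDerivAt (dzbar k ψ) ((1 / 2 : ℂ) •
        (fderiv ℝ (fun z => fderiv ℝ ψ z (Pi.single k 1)) z +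
          Complex.I • fderiv ℝ (fun z => fderiv ℝ ψ z (Pi.single k Complex.I)) z)) z :=
      ((h1 _ z).hasFDerivAt.add ((h1 _ z).hasFDerivAt.const_mul _)).const_mul _
    rw [hd.fderiv]
    rfl
  funext z
  have hsym : IsSymmSndFDerivAt ℝ ψ z := h.contDiffAt.isSymmSndFDerivAt (by
    simpa using WithTop.coe_le_coe.2 (le_top : (2 : ℕ∞) ≤ ⊤))
  rw [dzbar, dzbar]
  simp only [h3]
  rw [hsym (Pi.single j 1) (Pi.single k 1), hsym (Pi.single j 1) (Pi.single k Complex.I),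
    hsym (Pi.single j Complex.I) (Pi.single k 1),
    hsym (Pi.single j Complex.I) (Pi.single k Complex.I)]
  ring

omit [Fintype ι] in
theorem dbarSign_swap {I L : Finset ι} {j k : ι} (hj : j ∈ L) (hjk : j < k) :
    dbarSign k I L * dbarSign j I (L.erase k) = -(dbarSign j I L * dbarSign k I (L.erase j)) := by
  have h1 : ((L.erase k).filter (· < j)) = L.filter (· < j) := by
    ext x; simp only [Finset.mem_filter, Finset.mem_erase]
    exact ⟨fun h => ⟨h.1.2, h.2⟩, fun h => ⟨⟨(h.2.trans hjk).ne, h.1⟩, h.2⟩⟩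
  have h2 : ((L.erase j).filter (· < k)).card + 1 = (L.filter (· < k)).card := by
    rw [Finset.filter_erase]
    exact Finset.card_erase_add_one (Finset.mem_filter.2 ⟨hj, hjk⟩)
  simp only [dbarSign]
  rw [h1, ← h2]
  ring

/-- `∂̄² = 0`. -/
theorem dbar_range_le_ker (Ω : WeightedDomain ι) : rangeOp Ω.dbar ≤ kerOp Ω.dbar := by
  intro g hg
  obtain ⟨f, hf⟩ := mem_rangeOp.1 hg
  rw [mem_dbar_graph] at hf
  rw [mem_kerOp, mem_dbar_graph]
  intro I L ψ hψ
  have h0 : ∫ z in Ω.carrier, (0 : Ω.L2Forms) (I, L) z * ψ z = 0 := by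
    rw [hψ.setIntegral_mul]; simp
  rw [h0, zero_eq_neg]
  have h1 : ∀ k ∈ L, dbarSign k I L * ∫ z in Ω.carrier, g (I, L.erase k) z * dzbar k ψ z =
      -∑ j ∈ L.erase k, dbarSign k I L * dbarSign j I (L.erase k) *
        ∫ z in Ω.carrier, f (I, (L.erase k).erase j) z * dzbar j (dzbar k ψ) z := by
    intro k _
    rw [hf I (L.erase k) _ (hψ.dzbar k), mul_neg, Finset.mul_sum]
    simp only [mul_assoc]
  rw [Finset.sum_congr rfl h1, Finset.sum_neg_distrib, Finset.sum_sigma', neg_eq_zero]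
  -- the terms of `(k, j)` and `(j, k)` cancel
  refine Finset.sum_involution (fun x _ => ⟨x.2, x.1⟩) ?_ ?_ ?_ ?_
  · rintro ⟨k, j⟩ hx
    simp only [Finset.mem_sigma, Finset.mem_erase] at hx
    obtain ⟨hk, hjk, hj⟩ := hx
    have e : (L.erase j).erase k = (L.erase k).erase j := Finset.erase_right_comm
    simp only
    rw [e, dzbar_comm hψ.contDiff k j]
    rcases lt_or_gt_of_ne hjk with h | h
    · rw [dbarSign_swap hj h]; ring
    · rw [dbarSign_swap hk h]; ring
  · rintro ⟨k, j⟩ hx _ h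
    simp only [Finset.mem_sigma, Finset.mem_erase] at hx
    simp only [Sigma.mk.injEq] at h
    exact hx.2.1 h.1
  · rintro ⟨k, j⟩ hx
    simp only [Finset.mem_sigma, Finset.mem_erase] at hx ⊢
    exact ⟨hx.2.2, Ne.symm hx.2.1, hx.1⟩
  · rintro ⟨k, j⟩ _
    rfl

/-- `∂̄` is odd. -/
theorem sigma_graph (u g : Ω.L2Forms) (h : (u, g) ∈ Ω.dbar.graph) :
    (Ω.sigma u, -Ω.sigma g) ∈ Ω.dbar.graph := by
  rw [mem_dbar_graph_iff_inner] at h ⊢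
  intro I L ψ hψ
  rw [inner_neg_right, ← inner_sigma_left, ← inner_sigma_left, testForm, sigma_singleForm,
    inner_smul_left]
  have h1 : Ω.sigma (testFormAdjoint I L hψ) =
      -(((-1 : ℂ) ^ (I.card + L.card)) • testFormAdjoint I L hψ) := by
    simp only [testFormAdjoint, map_neg, map_sum, map_smul, sigma_singleForm, smul_neg,
      Finset.smul_sum, neg_neg, ← Finset.sum_neg_distrib]
    refine Finset.sum_congr rfl fun k hk => ?_
    rw [← Finset.card_erase_add_one hk, smul_smul, smul_smul, ← add_assoc, pow_succ]
    rw [← neg_smul]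
    congr 1
    ring
  rw [h1, inner_neg_left, inner_smul_left]
  have := h I L ψ hψ
  rw [testForm] at this
  rw [this]

/-- Forms of bidegree `(·, 0)` are orthogonal to the range of `∂̄`. -/
theorem degreeZero_mem (f : Ω.L2Forms) : Ω.degreeZero f ∈ (rangeOp Ω.dbar)ᗮ := by
  rw [Submodule.mem_orthogonal']
  intro g hg
  obtain ⟨u, hu⟩ := mem_rangeOp.1 hg
  rw [mem_dbar_graph] at hu
  rw [inner_degreeZero_left]
  have : Ω.degreeZero g = 0 := by
    ext1 ⟨I, L⟩
    rw [degreeZero_apply]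
    split_ifs with h
    · simp only at h
      subst h
      exact Ω.eq_zero_of_pairing fun ψ hψ => by simpa using hu I ∅ ψ hψ
    · rfl
  rw [this, inner_zero_right]

end Dbar

/-! ### Weak equations on a product domain -/

section Mollify

variable {E : Type*} [NormedAddCommGroup E] [NormedSpace ℝ E] [FiniteDimensional ℝ E]
  [MeasurableSpace E] [BorelSpace E] {μ : Measure E} [μ.IsAddHaarMeasure]

omit [NormedSpace ℝ E] [FiniteDimensional ℝ E] [μ.IsAddHaarMeasure] in
theorem integrable_mollify_prod [SecondCountableTopology E] [SigmaFinite μ] {F φ κ : E → ℂ}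
    {U : Set E} (hF : IntegrableOn F U μ) (hφ : Integrable φ μ) (hκ : Continuous κ)
    (hκs : HasCompactSupport κ) :
    Integrable (fun p : E × E => φ p.1 * (F p.2 * κ (p.2 - p.1))) (μ.prod (μ.restrict U)) := by
  obtain ⟨B, hB⟩ := hκs.exists_bound_of_continuous hκ
  have h := (hφ.mul_prod hF).mul_bdd (c := B) (g := fun p : E × E => κ (p.2 - p.1))
    (Continuous.aestronglyMeasurable (by fun_prop)) (Filter.Eventually.of_forall fun p => hB _)
  simpa only [mul_assoc] using h

omit [NormedSpace ℝ E] [FiniteDimensional ℝ E] [μ.IsAddHaarMeasure] in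
theorem integrable_mollify [SecondCountableTopology E] [SigmaFinite μ] {F φ κ : E → ℂ}
    {U : Set E} (hF : IntegrableOn F U μ) (hφ : Integrable φ μ) (hκ : Continuous κ)
    (hκs : HasCompactSupport κ) :
    Integrable (fun ξ => φ ξ * ∫ x in U, F x * κ (x - ξ) ∂μ) μ := by
  have h := (integrable_mollify_prod hF hφ hκ hκs).integral_prod_left
  simpa only [integral_const_mul] using h

omit [NormedSpace ℝ E] [FiniteDimensional ℝ E] [μ.IsAddHaarMeasure] in
theorem integral_mollify_swap [SecondCountableTopology E] [SigmaFinite μ] {F φ κ : E → ℂ}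
    {U : Set E} (hF : IntegrableOn F U μ) (hφ : Integrable φ μ) (hκ : Continuous κ)
    (hκs : HasCompactSupport κ) :
    ∫ ξ, φ ξ * ∫ x in U, F x * κ (x - ξ) ∂μ ∂μ = ∫ x in U, F x * ∫ ξ, φ ξ * κ (x - ξ) ∂μ ∂μ := by
  have h := integral_integral_swap (f := fun ξ x => φ ξ * (F x * κ (x - ξ)))
    (integrable_mollify_prod hF hφ hκ hκs)
  simp only [integral_const_mul] at h
  rw [h]
  congr 1 with x
  rw [← integral_const_mul]
  congr 1 with ξ
  ring

/-- Mollification changes the pairing of an integrable function with a uniformly continuous one by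
little. -/
theorem norm_integral_mollify_sub_le {F φ : E → ℂ} {ρ : E → ℝ} {U : Set E} {r η : ℝ}
    (hF : IntegrableOn F U μ) (hφ : Continuous φ) (hφs : HasCompactSupport φ) (hρ : Continuous ρ)
    (hρ0 : ∀ x, 0 ≤ ρ x) (hρ1 : ∫ x, ρ x ∂μ = 1) (hρs : Function.support ρ ⊆ Metric.ball 0 r)
    (hη : 0 ≤ η) (h : ∀ x y, dist x y < r → dist (φ x) (φ y) ≤ η) :
    ‖(∫ ξ, φ ξ * ∫ x in U, F x * ρ (x - ξ) ∂μ ∂μ) - ∫ x in U, F x * φ x ∂μ‖ ≤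
      η * ∫ x in U, ‖F x‖ ∂μ := by
  have hρc : HasCompactSupport (fun x => (ρ x : ℂ)) :=
    (HasCompactSupport.of_support_subset_isCompact (isCompact_closedBall (0 : E) r)
      (hρs.trans Metric.ball_subset_closedBall)).comp_left (g := fun x : ℝ => (x : ℂ)) (by simp)
  have hρco : Continuous (fun x => (ρ x : ℂ)) := Complex.continuous_ofReal.comp hρ
  obtain ⟨B, hB⟩ := hφs.exists_bound_of_continuous hφ
  have hφi : Integrable φ μ := hφ.integrable_of_hasCompactSupport hφs
  rw [integral_mollify_swap hF hφi hρco hρc]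
  have hconv : ∀ x, ‖(∫ ξ, φ ξ * ρ (x - ξ) ∂μ) - φ x‖ ≤ η := fun x => by
    have e : ∫ ξ, φ ξ * ρ (x - ξ) ∂μ =
        convolution ρ φ (ContinuousLinearMap.lsmul ℝ ℝ) μ x := by
      rw [convolution_def, ← integral_sub_left_eq_self _ μ x]
      congr 1 with t
      simp [mul_comm]
    rw [e, ← dist_eq_norm]
    exact dist_convolution_le hη hρs hρ0 hρ1 hφ.aestronglyMeasurable fun y hy =>
      h y x (Metric.mem_ball.1 hy)
  have hi : Integrable (fun x => F x * ∫ ξ, φ ξ * ρ (x - ξ) ∂μ) (μ.restrict U) := by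
    have := (integrable_mollify_prod hF hφi hρco hρc).integral_prod_right
    refine this.congr (Filter.Eventually.of_forall fun x => ?_)
    simp only
    rw [← integral_const_mul]
    congr 1 with ξ
    ring
  have hi' : Integrable (fun x => F x * φ x) (μ.restrict U) :=
    hF.mul_bdd (c := B) hφ.aestronglyMeasurable (Filter.Eventually.of_forall hB)
  rw [← integral_sub hi hi', ← integral_const_mul]
  refine norm_integral_le_of_norm_le (hF.norm.const_mul η) (Filter.Eventually.of_forall fun x => ?_)
  rw [← mul_sub, norm_mul, mul_comm]
  exact mul_le_mul_of_nonneg_right (hconv x) (norm_nonneg _)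

end Mollify

section Parts

variable {ι : Type*} [Fintype ι] [LinearOrder ι]

theorem continuous_dzbar {ψ : (ι → ℂ) → ℂ} (h : ContDiff ℝ ∞ ψ) (k : ι) :
    Continuous (dzbar k ψ) := by
  have hd : ∀ v, Continuous (fun z => fderiv ℝ ψ z v) := fun v =>
    (h.continuous_fderiv (by simp)).clm_apply continuous_const
  exact continuous_const.mul ((hd _).add (continuous_const.mul (hd _)))

omit [Fintype ι] in
theorem hasCompactSupport_dzbar {ψ : (ι → ℂ) → ℂ} (h : HasCompactSupport ψ) (k : ι) :
    HasCompactSupport (dzbar k ψ) :=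
  ((h.fderiv_apply ℝ _).add ((h.fderiv_apply ℝ _).mul_left (f := fun _ => Complex.I))).mul_left
    (f := fun _ => 1 / 2)

theorem dzbar_comp_sub (k : ι) (κ : (ι → ℂ) → ℂ) (ξ x : ι → ℂ) :
    dzbar k (fun y => κ (y - ξ)) x = dzbar k κ (x - ξ) := by
  simp only [dzbar, fderiv_comp_sub]

/-- Integration by parts: the sign cancels against the one from differentiating `ξ ↦ κ (x - ξ)`. -/
theorem integral_dzbar_mollify {ψ κ : (ι → ℂ) → ℂ} (hψ : ContDiff ℝ ∞ ψ)
    (hψs : HasCompactSupport ψ) (hκ : ContDiff ℝ ∞ κ) (k : ι) (x : ι → ℂ) :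
    ∫ ξ, ψ ξ * dzbar k κ (x - ξ) = ∫ ξ, dzbar k ψ ξ * κ (x - ξ) := by
  have hκ' : ContDiff ℝ ∞ (fun ξ => κ (x - ξ)) := hκ.comp (contDiff_const.sub contDiff_id)
  have hi : ∀ {a b : (ι → ℂ) → ℂ}, Continuous a → HasCompactSupport a → Continuous b →
      Integrable (fun z => a z * b z) := fun ha hs hb =>
    (ha.mul hb).integrable_of_hasCompactSupport hs.mul_right
  have hd : ∀ {a : (ι → ℂ) → ℂ}, ContDiff ℝ ∞ a → ∀ v, Continuous (fun z => fderiv ℝ a z v) :=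
    fun ha v => (ha.continuous_fderiv (by simp)).clm_apply continuous_const
  have hv : ∀ v, ∫ ξ, ψ ξ * fderiv ℝ κ (x - ξ) v = ∫ ξ, fderiv ℝ ψ ξ v * κ (x - ξ) := by
    intro v
    have e : ∀ ξ, fderiv ℝ (fun ξ => κ (x - ξ)) ξ v = -fderiv ℝ κ (x - ξ) v := fun ξ => by
      have h : HasFDerivAt (fun ξ => κ (x - ξ)) _ ξ :=
        (hκ.differentiable (by simp) (x - ξ)).hasFDerivAt.comp ξ ((hasFDerivAt_id ξ).const_sub x)
      rw [h.fderiv]; simp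
    have := integral_mul_fderiv_eq_neg_fderiv_mul_of_integrable (μ := volume) (v := v)
      (hi (hd hψ v) (hψs.fderiv_apply ℝ v) hκ'.continuous)
      (hi hψ.continuous hψs (hd hκ' v)) (hi hψ.continuous hψs hκ'.continuous)
      (fun x _ => hψ.differentiable (by simp) x) (fun x _ => hκ'.differentiable (by simp) x)
    simp only [e, mul_neg, integral_neg, neg_inj] at this
    exact this
  have hdx : ∀ v, Continuous (fun ξ => fderiv ℝ κ (x - ξ) v) := fun v =>
    (hd hκ v).comp (continuous_const.sub continuous_id)
  have l : ∀ ξ, ψ ξ * dzbar k κ (x - ξ) = (1 / 2) *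
      (ψ ξ * fderiv ℝ κ (x - ξ) (Pi.single k 1) +
        Complex.I * (ψ ξ * fderiv ℝ κ (x - ξ) (Pi.single k Complex.I))) :=
    fun z => by simp only [WeightedDomain.dzbar]; ring
  have r : ∀ ξ, dzbar k ψ ξ * κ (x - ξ) = (1 / 2) *
      (fderiv ℝ ψ ξ (Pi.single k 1) * κ (x - ξ) +
        Complex.I * (fderiv ℝ ψ ξ (Pi.single k Complex.I) * κ (x - ξ))) :=
    fun z => by simp only [WeightedDomain.dzbar]; ring
  simp_rw [l, r]
  rw [integral_const_mul, integral_const_mul, integral_add, integral_add, integral_const_mul,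
    integral_const_mul, hv, hv]
  · exact hi (hd hψ _) (hψs.fderiv_apply ℝ _) hκ'.continuous
  · exact (hi (hd hψ _) (hψs.fderiv_apply ℝ _) hκ'.continuous).const_mul _
  · exact hi hψ.continuous hψs (hdx _)
  · exact (hi hψ.continuous hψs (hdx _)).const_mul _

end Parts

section Product

variable {ι₁ ι₂ : Type*} [Fintype ι₁] [Fintype ι₂]

/-- The function `(z, w) ↦ a(z) b(w)`. -/
def mulFun (a : (ι₁ → ℂ) → ℂ) (b : (ι₂ → ℂ) → ℂ) (x : (ι₁ ⊕ₗ ι₂) → ℂ) : ℂ :=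
  a (split x).1 * b (split x).2

theorem norm_join (x : (ι₁ → ℂ) × (ι₂ → ℂ)) : ‖join x‖ = ‖x‖ := by
  refine le_antisymm ?_ ?_
  · refine (pi_norm_le_iff_of_nonneg (norm_nonneg _)).2 fun i => ?_
    rcases i with i | i
    · exact (norm_le_pi_norm x.1 i).trans (norm_fst_le x)
    · exact (norm_le_pi_norm x.2 i).trans (norm_snd_le x)
  · refine max_le ?_ ?_
    · exact (pi_norm_le_iff_of_nonneg (norm_nonneg _)).2 fun i =>
        norm_le_pi_norm (join x) (Sum.inlₗ i)
    · exact (pi_norm_le_iff_of_nonneg (norm_nonneg _)).2 fun i =>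
        norm_le_pi_norm (join x) (Sum.inrₗ i)

/-- The first component of `split` as a continuous linear map. -/
def splitFst : ((ι₁ ⊕ₗ ι₂) → ℂ) →L[ℝ] (ι₁ → ℂ) :=
  ContinuousLinearMap.pi fun i => ContinuousLinearMap.proj (Sum.inlₗ i)

/-- The second component of `split` as a continuous linear map. -/
def splitSnd : ((ι₁ ⊕ₗ ι₂) → ℂ) →L[ℝ] (ι₂ → ℂ) :=
  ContinuousLinearMap.pi fun i => ContinuousLinearMap.proj (Sum.inrₗ i)

theorem contDiff_mulFun {a : (ι₁ → ℂ) → ℂ} {b : (ι₂ → ℂ) → ℂ} (ha : ContDiff ℝ ∞ a)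
    (hb : ContDiff ℝ ∞ b) : ContDiff ℝ ∞ (mulFun a b) :=
  (ha.comp (splitFst (ι₁ := ι₁) (ι₂ := ι₂)).contDiff).mul
    (hb.comp (splitSnd (ι₁ := ι₁) (ι₂ := ι₂)).contDiff)

theorem fderiv_mulFun {a : (ι₁ → ℂ) → ℂ} {b : (ι₂ → ℂ) → ℂ} (ha : Differentiable ℝ a)
    (hb : Differentiable ℝ b) (x v : (ι₁ ⊕ₗ ι₂) → ℂ) :
    fderiv ℝ (mulFun a b) x v = a (split x).1 * fderiv ℝ b (split x).2 (split v).2 +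
      fderiv ℝ a (split x).1 (split v).1 * b (split x).2 := by
  have h1 : HasFDerivAt (fun x => a (splitFst (ι₁ := ι₁) (ι₂ := ι₂) x)) _ x :=
    (ha (split x).1).hasFDerivAt.comp x splitFst.hasFDerivAt
  have h2 : HasFDerivAt (fun x => b (splitSnd (ι₁ := ι₁) (ι₂ := ι₂) x)) _ x :=
    (hb (split x).2).hasFDerivAt.comp x splitSnd.hasFDerivAt
  have h3 : HasFDerivAt (mulFun a b) _ x := h1.mul h2
  rw [h3.fderiv]
  simp only [add_apply, smul_apply,
    ContinuousLinearMap.comp_apply, smul_eq_mul]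
  rw [mul_comm (b _)]
  rfl

omit [Fintype ι₁] [Fintype ι₂] in
theorem split_single_inl [DecidableEq (ι₁ ⊕ₗ ι₂)] [DecidableEq ι₁] (k : ι₁) (c : ℂ) :
    split (Pi.single (Sum.inlₗ k) c : (ι₁ ⊕ₗ ι₂) → ℂ) = (Pi.single k c, 0) := by
  refine Prod.ext (funext fun i => ?_) (funext fun j => ?_)
  · simp only [split, Pi.single_apply]
    congr 1
    simp
  · simp [split, Pi.single_apply]

omit [Fintype ι₁] [Fintype ι₂] in
theorem split_single_inr [DecidableEq (ι₁ ⊕ₗ ι₂)] [DecidableEq ι₂] (k : ι₂) (c : ℂ) :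
    split (Pi.single (Sum.inrₗ k) c : (ι₁ ⊕ₗ ι₂) → ℂ) = (0, Pi.single k c) := by
  refine Prod.ext (funext fun i => ?_) (funext fun j => ?_)
  · simp [split, Pi.single_apply]
  · simp only [split, Pi.single_apply]
    congr 1
    simp

section Order

variable [LinearOrder ι₁] [LinearOrder ι₂]

theorem dzbar_mulFun_inl {a : (ι₁ → ℂ) → ℂ} {b : (ι₂ → ℂ) → ℂ} (ha : Differentiable ℝ a)
    (hb : Differentiable ℝ b) (k : ι₁) :
    dzbar (Sum.inlₗ k) (mulFun a b) = mulFun (dzbar k a) b := by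
  funext x
  simp only [dzbar, mulFun, fderiv_mulFun ha hb, split_single_inl, map_zero]
  ring

theorem dzbar_mulFun_inr {a : (ι₁ → ℂ) → ℂ} {b : (ι₂ → ℂ) → ℂ} (ha : Differentiable ℝ a)
    (hb : Differentiable ℝ b) (k : ι₂) :
    dzbar (Sum.inrₗ k) (mulFun a b) = mulFun a (dzbar k b) := by
  funext x
  simp only [dzbar, mulFun, fderiv_mulFun ha hb, split_single_inr, map_zero]
  ring

theorem support_comp_sub_subset {E : Type*} [SeminormedAddCommGroup E] {f : E → ℂ} {r : ℝ}
    (hf : Function.support f ⊆ Metric.ball 0 r) (η : E) :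
    Function.support (fun z => f (z - η)) ⊆ Metric.closedBall η r := by
  intro z hz
  have := hf (show z - η ∈ Function.support f from hz)
  rw [mem_ball_zero_iff] at this
  rw [mem_closedBall_iff_norm]
  exact this.le

/-- Mollifiers that are products: smooth functions `ρ ≥ 0` of integral one, supported in small
balls, whose translates to a point `ξ` are products of test functions as soon as the domain contains
a small ball about `ξ`. -/
theorem exists_product_mollifier (Ω₁ : WeightedDomain ι₁) (Ω₂ : WeightedDomain ι₂) {r : ℝ}
    (hr : 0 < r) : ∃ ρ : ((ι₁ ⊕ₗ ι₂) → ℂ) → ℝ, ContDiff ℝ ∞ (fun x => (ρ x : ℂ)) ∧ (∀ x, 0 ≤ ρ x) ∧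
      ∫ x, ρ x = 1 ∧ Function.support ρ ⊆ Metric.ball 0 r ∧
      ∀ ξ, Metric.closedBall ξ r ⊆ (Ω₁.prod Ω₂).carrier → ∃ a b, Ω₁.IsTest a ∧ Ω₂.IsTest b ∧
        (fun x => (ρ (x - ξ) : ℂ)) = mulFun a b := by
  let b₁ : ContDiffBump (0 : ι₁ → ℂ) := ⟨r / 2, r, by positivity, by linarith⟩
  let b₂ : ContDiffBump (0 : ι₂ → ℂ) := ⟨r / 2, r, by positivity, by linarith⟩
  let f₁ : (ι₁ → ℂ) → ℂ := fun z => (b₁.normed volume z : ℂ)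
  let f₂ : (ι₂ → ℂ) → ℂ := fun z => (b₂.normed volume z : ℂ)
  have hf₁ : ContDiff ℝ ∞ f₁ := Complex.ofRealCLM.contDiff.comp b₁.contDiff_normed
  have hf₂ : ContDiff ℝ ∞ f₂ := Complex.ofRealCLM.contDiff.comp b₂.contDiff_normed
  have hs₁ : Function.support f₁ ⊆ Metric.ball 0 r := fun z hz => by
    rw [← b₁.support_normed_eq (μ := volume)]
    exact fun h => hz (by simp [f₁, h])
  have hs₂ : Function.support f₂ ⊆ Metric.ball 0 r := fun z hz => by
    rw [← b₂.support_normed_eq (μ := volume)]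
    exact fun h => hz (by simp [f₂, h])
  have hρ : ∀ x, (((b₁.normed volume (split x).1 * b₂.normed volume (split x).2 : ℝ)) : ℂ) =
      mulFun f₁ f₂ x := fun x => by simp [mulFun, f₁, f₂]
  refine ⟨fun x => b₁.normed volume (split x).1 * b₂.normed volume (split x).2, ?_, fun x =>
    mul_nonneg (b₁.nonneg_normed _) (b₂.nonneg_normed _), ?_, ?_, ?_⟩
  · simp only [hρ]
    exact contDiff_mulFun hf₁ hf₂
  · have h1 := measurePreserving_split.integral_comp measurableEmbedding_split
      (fun y : (ι₁ → ℂ) × (ι₂ → ℂ) => b₁.normed volume y.1 * b₂.normed volume y.2)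
    rw [h1]
    have h2 := integral_prod_mul (μ := volume) (ν := volume) (b₁.normed volume) (b₂.normed volume)
    rw [b₁.integral_normed, b₂.integral_normed, one_mul] at h2
    exact h2
  · intro x hx
    have h1 : (split x).1 ∈ Metric.ball (0 : ι₁ → ℂ) r := by
      refine hs₁ fun h => hx ?_
      have : b₁.normed volume (split x).1 = 0 := Complex.ofReal_eq_zero.1 h
      simp [this]
    have h2 : (split x).2 ∈ Metric.ball (0 : ι₂ → ℂ) r := by
      refine hs₂ fun h => hx ?_
      have : b₂.normed volume (split x).2 = 0 := Complex.ofReal_eq_zero.1 h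
      simp [this]
    rw [mem_ball_zero_iff] at h1 h2 ⊢
    rw [← join_split x, norm_join]
    exact max_lt h1 h2
  · intro ξ hξ
    refine ⟨fun z => f₁ (z - (split ξ).1), fun w => f₂ (w - (split ξ).2), ⟨?_, ?_, ?_⟩,
      ⟨?_, ?_, ?_⟩, ?_⟩
    · exact hf₁.comp (contDiff_id.sub contDiff_const)
    · exact HasCompactSupport.of_support_subset_isCompact (isCompact_closedBall _ _)
        (support_comp_sub_subset hs₁ _)
    · refine (closure_minimal (support_comp_sub_subset hs₁ _)
        Metric.isClosed_closedBall).trans fun z hz => ?_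
      have : join (z, (split ξ).2) ∈ Metric.closedBall ξ r := by
        rw [mem_closedBall_iff_norm] at hz ⊢
        have e : join (z, (split ξ).2) - ξ = join (z - (split ξ).1, 0) := by
          funext i
          rcases i with i | i
          · rfl
          · exact sub_self _
        rw [e, norm_join]
        simpa [Prod.norm_def] using hz
      exact (hξ this).1
    · exact hf₂.comp (contDiff_id.sub contDiff_const)
    · exact HasCompactSupport.of_support_subset_isCompact (isCompact_closedBall _ _)
        (support_comp_sub_subset hs₂ _)
    · refine (closure_minimal (support_comp_sub_subset hs₂ _)
        Metric.isClosed_closedBall).trans fun z hz => ?_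
      have : join ((split ξ).1, z) ∈ Metric.closedBall ξ r := by
        rw [mem_closedBall_iff_norm] at hz ⊢
        have e : join ((split ξ).1, z) - ξ = join (0, z - (split ξ).2) := by
          funext i
          rcases i with i | i
          · exact sub_self _
          · rfl
        rw [e, norm_join]
        simpa [Prod.norm_def] using hz
      exact (hξ this).2
    · funext x
      exact hρ (x - ξ)

/-- Integrating a weak equation over the translates `ρ (· - ξ)` of a mollifier with weight `ψ ξ`
gives the equation for the mollification of `ψ`. -/
theorem mollified_equation {Ω₁ : WeightedDomain ι₁} {Ω₂ : WeightedDomain ι₂}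
    {G : ((ι₁ ⊕ₗ ι₂) → ℂ) → ℂ} {F : (ι₁ ⊕ₗ ι₂) → ((ι₁ ⊕ₗ ι₂) → ℂ) → ℂ}
    (hG : IntegrableOn G (Ω₁.prod Ω₂).carrier) (hF : ∀ k, IntegrableOn (F k) (Ω₁.prod Ω₂).carrier)
    (L : Finset (ι₁ ⊕ₗ ι₂)) (c : (ι₁ ⊕ₗ ι₂) → ℂ)
    (h : ∀ a b, Ω₁.IsTest a → Ω₂.IsTest b →
      (∫ x in (Ω₁.prod Ω₂).carrier, G x * mulFun a b x) +
        ∑ k ∈ L, c k * ∫ x in (Ω₁.prod Ω₂).carrier, F k x * dzbar k (mulFun a b) x = 0)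
    {ψ : ((ι₁ ⊕ₗ ι₂) → ℂ) → ℂ} (hψ : (Ω₁.prod Ω₂).IsTest ψ) {ρ : ((ι₁ ⊕ₗ ι₂) → ℂ) → ℝ}
    (hρ : ContDiff ℝ ∞ (fun x => (ρ x : ℂ))) (hρc : HasCompactSupport (fun x => (ρ x : ℂ)))
    (hρt : ∀ ξ ∈ tsupport ψ, ∃ a b, Ω₁.IsTest a ∧ Ω₂.IsTest b ∧
        (fun x => (ρ (x - ξ) : ℂ)) = mulFun a b) :
    (∫ ξ, ψ ξ * ∫ x in (Ω₁.prod Ω₂).carrier, G x * ρ (x - ξ)) +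
      ∑ k ∈ L, c k * ∫ ξ, dzbar k ψ ξ * ∫ x in (Ω₁.prod Ω₂).carrier, F k x * ρ (x - ξ) = 0 := by
  have hκc : ∀ k, Continuous (dzbar k (fun x => (ρ x : ℂ))) := fun k => continuous_dzbar hρ k
  have hκs : ∀ k, HasCompactSupport (dzbar k (fun x => (ρ x : ℂ))) := fun k =>
    hasCompactSupport_dzbar hρc k
  have hψi : Integrable ψ :=
    hψ.contDiff.continuous.integrable_of_hasCompactSupport hψ.hasCompactSupport
  have hdi : ∀ k, Integrable (dzbar k ψ) := fun k =>
    (hψ.dzbar k).contDiff.continuous.integrable_of_hasCompactSupport (hψ.dzbar k).hasCompactSupport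
  have hparts : ∀ k, ∫ ξ, dzbar k ψ ξ * ∫ x in (Ω₁.prod Ω₂).carrier, F k x * ρ (x - ξ) =
      ∫ ξ, ψ ξ * ∫ x in (Ω₁.prod Ω₂).carrier, F k x * dzbar k (fun x => (ρ x : ℂ)) (x - ξ) :=
    fun k => by
      rw [integral_mollify_swap (hF k) (hdi k) hρ.continuous hρc,
        integral_mollify_swap (hF k) hψi (hκc k) (hκs k)]
      congr 1 with x
      rw [integral_dzbar_mollify hψ.contDiff hψ.hasCompactSupport hρ]
  have hi0 := integrable_mollify hG hψi hρ.continuous hρc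
  have hi : ∀ k, Integrable (fun ξ => c k * (ψ ξ *
      ∫ x in (Ω₁.prod Ω₂).carrier, F k x * dzbar k (fun x => (ρ x : ℂ)) (x - ξ))) := fun k =>
    (integrable_mollify (hF k) hψi (hκc k) (hκs k)).const_mul _
  simp only [hparts]
  rw [Finset.sum_congr rfl fun k _ => (integral_const_mul (c k) _).symm,
    ← integral_finsetSum _ fun k _ => hi k,
    ← integral_add hi0 (integrable_finsetSum _ fun k _ => hi k)]
  refine integral_eq_zero_of_ae (Filter.Eventually.of_forall fun ξ => ?_)
  simp only [Pi.zero_apply]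
  by_cases hξ : ξ ∈ tsupport ψ
  · obtain ⟨a, b, ha, hb, hab⟩ := hρt ξ hξ
    have := h a b ha hb
    rw [← hab] at this
    simp only [dzbar_comp_sub _ (fun x => (ρ x : ℂ))] at this
    have h2 := congrArg (fun t => ψ ξ * t) this
    simp only [mul_add, Finset.mul_sum, mul_zero] at h2
    rw [← h2]
    congr 1
    exact Finset.sum_congr rfl fun k _ => mul_left_comm _ _ _
  · simp [image_eq_zero_of_notMem_tsupport hξ]

/-- A first order weak equation on a product domain has to be tested on products of test functions
only: it then holds for the mollification of an arbitrary test function by a product mollifier. -/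
theorem weak_equation_of_mulFun (Ω₁ : WeightedDomain ι₁) (Ω₂ : WeightedDomain ι₂)
    {G : ((ι₁ ⊕ₗ ι₂) → ℂ) → ℂ} {F : (ι₁ ⊕ₗ ι₂) → ((ι₁ ⊕ₗ ι₂) → ℂ) → ℂ}
    (hG : IntegrableOn G (Ω₁.prod Ω₂).carrier) (hF : ∀ k, IntegrableOn (F k) (Ω₁.prod Ω₂).carrier)
    (L : Finset (ι₁ ⊕ₗ ι₂)) (c : (ι₁ ⊕ₗ ι₂) → ℂ)
    (h : ∀ a b, Ω₁.IsTest a → Ω₂.IsTest b →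
      (∫ x in (Ω₁.prod Ω₂).carrier, G x * mulFun a b x) +
        ∑ k ∈ L, c k * ∫ x in (Ω₁.prod Ω₂).carrier, F k x * dzbar k (mulFun a b) x = 0)
    {ψ : ((ι₁ ⊕ₗ ι₂) → ℂ) → ℂ} (hψ : (Ω₁.prod Ω₂).IsTest ψ) :
    (∫ x in (Ω₁.prod Ω₂).carrier, G x * ψ x) +
        ∑ k ∈ L, c k * ∫ x in (Ω₁.prod Ω₂).carrier, F k x * dzbar k ψ x = 0 := by
  set U := (Ω₁.prod Ω₂).carrier with hU
  set M : ℝ := (∫ x in U, ‖G x‖) + ∑ k ∈ L, ‖c k‖ * ∫ x in U, ‖F k x‖ with hM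
  have hM0 : 0 ≤ M := by
    refine add_nonneg (integral_nonneg fun _ => norm_nonneg _) (Finset.sum_nonneg fun k _ =>
      mul_nonneg (norm_nonneg _) (integral_nonneg fun _ => norm_nonneg _))
  suffices hη : ∀ η : ℝ, 0 < η → ‖(∫ x in U, G x * ψ x) +
      ∑ k ∈ L, c k * ∫ x in U, F k x * dzbar k ψ x‖ ≤ η * M by
    rw [← norm_eq_zero]
    refine le_antisymm (le_of_forall_pos_le_add fun ε hε => ?_) (norm_nonneg _)
    refine (hη (ε / (M + 1)) (by positivity)).trans ?_
    rw [zero_add, div_mul_eq_mul_div, div_le_iff₀ (by positivity)]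
    nlinarith
  intro η hη
  -- uniform continuity of `ψ` and its derivatives
  have huc : ∀ φ : ((ι₁ ⊕ₗ ι₂) → ℂ) → ℂ, Continuous φ → HasCompactSupport φ →
      ∃ r > 0, ∀ x y, dist x y < r → dist (φ x) (φ y) ≤ η := fun φ hφ hφs => by
    obtain ⟨r, hr, h⟩ := Metric.uniformContinuous_iff.1
      (hφs.uniformContinuous_of_continuous hφ) η hη
    exact ⟨r, hr, fun x y hxy => (h hxy).le⟩
  have hψc := hψ.contDiff.continuous
  have hdc : ∀ k, Continuous (dzbar k ψ) := fun k => (hψ.dzbar k).contDiff.continuous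
  have hds : ∀ k, HasCompactSupport (dzbar k ψ) := fun k => (hψ.dzbar k).hasCompactSupport
  obtain ⟨r₀, hr₀, h₀⟩ := huc ψ hψc hψ.hasCompactSupport
  choose r' hr' h' using fun k => huc (dzbar k ψ) (hdc k) (hds k)
  obtain ⟨δ, hδ, hδU⟩ := hψ.hasCompactSupport.isCompact.exists_cthickening_subset_open
    (Ω₁.prod Ω₂).isOpen hψ.tsupport_subset
  obtain ⟨r, hr, hrr₀, hrδ, hrr'⟩ : ∃ r > 0, r ≤ r₀ ∧ r ≤ δ ∧ ∀ k, r ≤ r' k := by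
    have hev : ∀ s : ℝ, 0 < s → ∀ᶠ r in nhdsWithin (0 : ℝ) (Set.Ioi 0), r ≤ s := fun s hs =>
      nhdsWithin_le_nhds (Iic_mem_nhds hs)
    have := (eventually_mem_nhdsWithin (a := (0 : ℝ)) (s := Set.Ioi 0)).and
      ((hev r₀ hr₀).and ((hev δ hδ).and
        (Filter.eventually_all.2 fun k => hev (r' k) (hr' k))))
    obtain ⟨r, h1, h2, h3, h4⟩ := this.exists
    exact ⟨r, h1, h2, h3, h4⟩
  obtain ⟨ρ, hρ, hρ0, hρ1, hρs, hρt⟩ := exists_product_mollifier Ω₁ Ω₂ hr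
  have hρr : Continuous ρ := by
    have := Complex.continuous_re.comp hρ.continuous
    exact this
  have hρc : HasCompactSupport (fun x => (ρ x : ℂ)) :=
    (HasCompactSupport.of_support_subset_isCompact (isCompact_closedBall _ r)
      (hρs.trans Metric.ball_subset_closedBall)).comp_left (g := fun x : ℝ => (x : ℂ)) (by simp)
  have hmoll := mollified_equation hG hF L c h hψ hρ hρc fun ξ hξ =>
    hρt ξ (((Metric.closedBall_subset_closedBall hrδ).trans
      (Metric.closedBall_subset_cthickening hξ δ)).trans hδU)
  have e1 := norm_integral_mollify_sub_le hG hψc hψ.hasCompactSupport hρr hρ0 hρ1 hρs hη.le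
    fun x y hxy => h₀ x y (hxy.trans_le hrr₀)
  have e2 := fun k => norm_integral_mollify_sub_le (hF k) (hdc k) (hds k) hρr hρ0 hρ1 hρs hη.le
    fun x y hxy => h' k x y (hxy.trans_le (hrr' k))
  rw [← sub_zero (_ + _), ← hmoll, norm_sub_rev, add_sub_add_comm, ← Finset.sum_sub_distrib]
  refine (norm_add_le _ _).trans ?_
  rw [hM, mul_add, Finset.mul_sum]
  refine add_le_add e1 ((norm_sum_le _ _).trans (Finset.sum_le_sum fun k _ => ?_))
  rw [← mul_sub, norm_mul, mul_left_comm]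
  exact mul_le_mul_of_nonneg_left (e2 k) (norm_nonneg _)

end Order

end Product

/-! ### Tensor products of forms -/

section Parts

variable {ι₁ ι₂ : Type*}

theorem mem_leftPart {I : Finset (ι₁ ⊕ₗ ι₂)} {k : ι₁} : k ∈ leftPart I ↔ Sum.inlₗ k ∈ I :=
  Finset.mem_toLeft (α := ι₁) (β := ι₂)

theorem mem_rightPart {I : Finset (ι₁ ⊕ₗ ι₂)} {k : ι₂} : k ∈ rightPart I ↔ Sum.inrₗ k ∈ I :=
  Finset.mem_toRight (α := ι₁) (β := ι₂)

theorem card_parts (I : Finset (ι₁ ⊕ₗ ι₂)) :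
    I.card = (leftPart I).card + (rightPart I).card :=
  (Finset.card_toLeft_add_card_toRight (α := ι₁) (β := ι₂)).symm

theorem parts_inj {I J : Finset (ι₁ ⊕ₗ ι₂)} (h : leftPart I = leftPart J)
    (h' : rightPart I = rightPart J) : I = J :=
  partsEquiv.injective (Prod.ext h h')

theorem sum_parts {M : Type*} [AddCommMonoid M] (L : Finset (ι₁ ⊕ₗ ι₂)) (F : (ι₁ ⊕ₗ ι₂) → M) :
    ∑ k ∈ L, F k = ∑ k ∈ leftPart L, F (Sum.inlₗ k) + ∑ k ∈ rightPart L, F (Sum.inrₗ k) :=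
  Finset.sum_sum_eq_sum_toLeft_add_sum_toRight (ι := ι₁) (κ := ι₂) L F

variable [LinearOrder ι₁] [LinearOrder ι₂]

theorem leftPart_erase_inl (L : Finset (ι₁ ⊕ₗ ι₂)) (k : ι₁) :
    leftPart (L.erase (Sum.inlₗ k)) = (leftPart L).erase k := by
  ext j
  simp [mem_leftPart]

theorem rightPart_erase_inl (L : Finset (ι₁ ⊕ₗ ι₂)) (k : ι₁) :
    rightPart (L.erase (Sum.inlₗ k)) = rightPart L := by
  ext j
  simp [mem_rightPart]

theorem leftPart_erase_inr (L : Finset (ι₁ ⊕ₗ ι₂)) (k : ι₂) :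
    leftPart (L.erase (Sum.inrₗ k)) = leftPart L := by
  ext j
  simp [mem_leftPart]

theorem rightPart_erase_inr (L : Finset (ι₁ ⊕ₗ ι₂)) (k : ι₂) :
    rightPart (L.erase (Sum.inrₗ k)) = (rightPart L).erase k := by
  ext j
  simp [mem_rightPart]

theorem dbarSign_inl (k : ι₁) (I L : Finset (ι₁ ⊕ₗ ι₂)) :
    dbarSign (Sum.inlₗ k) I L =
      (-1) ^ (rightPart I).card * dbarSign k (leftPart I) (leftPart L) := by
  have h : (L.filter (· < Sum.inlₗ k)).card = ((leftPart L).filter (· < k)).card := by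
    rw [card_parts]
    have h1 : leftPart (L.filter (· < Sum.inlₗ k)) = (leftPart L).filter (· < k) := by
      ext j; simp [mem_leftPart]
    have h2 : rightPart (L.filter (· < Sum.inlₗ k)) = ∅ := by
      ext j; simp [mem_rightPart]
    rw [h1, h2, Finset.card_empty, add_zero]
  rw [dbarSign, dbarSign, h, card_parts I]
  ring

theorem dbarSign_inr (k : ι₂) (I L : Finset (ι₁ ⊕ₗ ι₂)) :
    dbarSign (Sum.inrₗ k) I L = (-1) ^ ((leftPart I).card + (leftPart L).card) *
      dbarSign k (rightPart I) (rightPart L) := by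
  have h : (L.filter (· < Sum.inrₗ k)).card =
      (leftPart L).card + ((rightPart L).filter (· < k)).card := by
    rw [card_parts]
    have h1 : leftPart (L.filter (· < Sum.inrₗ k)) = leftPart L := by
      ext j; simp [mem_leftPart]
    have h2 : rightPart (L.filter (· < Sum.inrₗ k)) = (rightPart L).filter (· < k) := by
      ext j; simp [mem_rightPart]
    rw [h1, h2]
  rw [dbarSign, dbarSign, h, card_parts I]
  ring

end Parts

section Tensor

variable {ι₁ ι₂ : Type*} [Fintype ι₁] [Fintype ι₂]
  {Ω₁ : WeightedDomain ι₁} {Ω₂ : WeightedDomain ι₂}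

theorem mulLp_zero_left (b : Lp ℂ 2 Ω₂.measure) : mulLp Ω₁ Ω₂ 0 b = 0 := by
  simpa using mulLp_smul_left Ω₁ Ω₂ 0 0 b

theorem mulLp_zero_right (a : Lp ℂ 2 Ω₁.measure) : mulLp Ω₁ Ω₂ a 0 = 0 := by
  simpa using mulLp_smul_right Ω₁ Ω₂ 0 a 0

theorem norm_tensorForm (x : Ω₁.L2Forms) (y : Ω₂.L2Forms) :
    ‖tensorForm Ω₁ Ω₂ x y‖ = ‖x‖ * ‖y‖ := by
  have h := inner_tensorForm Ω₁ Ω₂ x x y y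
  simp only [inner_self_eq_norm_sq_to_K] at h
  have h' : ‖tensorForm Ω₁ Ω₂ x y‖ ^ 2 = (‖x‖ * ‖y‖) ^ 2 := by
    rw [mul_pow]; exact_mod_cast h
  exact (pow_left_inj₀ (norm_nonneg _) (by positivity) two_ne_zero).1 h'

variable (Ω₁) in
/-- The bounded operator `x ↦ x ⊗ y`. Its adjoint is the contraction with `y`. -/
def tensorRight (y : Ω₂.L2Forms) : Ω₁.L2Forms →L[ℂ] (Ω₁.prod Ω₂).L2Forms :=
  LinearMap.mkContinuous (tensorLinear Ω₁ Ω₂ ∘ₗ (TensorProduct.mk ℂ _ _).flip y) ‖y‖ fun x =>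
    (norm_tensorForm x y).le.trans_eq (mul_comm _ _)

variable (Ω₂) in
/-- The bounded operator `y ↦ x ⊗ y`. Its adjoint is the contraction with `x`. -/
def tensorLeft (x : Ω₁.L2Forms) : Ω₂.L2Forms →L[ℂ] (Ω₁.prod Ω₂).L2Forms :=
  LinearMap.mkContinuous (tensorLinear Ω₁ Ω₂ ∘ₗ TensorProduct.mk ℂ _ _ x) ‖x‖ fun y =>
    (norm_tensorForm x y).le

theorem tensorRight_apply (x : Ω₁.L2Forms) (y : Ω₂.L2Forms) :
    tensorRight Ω₁ y x = tensorForm Ω₁ Ω₂ x y := rfl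

theorem tensorLeft_apply (x : Ω₁.L2Forms) (y : Ω₂.L2Forms) :
    tensorLeft Ω₂ x y = tensorForm Ω₁ Ω₂ x y := rfl

theorem inner_adjoint_tensorRight (x : Ω₁.L2Forms) (y : Ω₂.L2Forms) (f : (Ω₁.prod Ω₂).L2Forms) :
    ⟪x, (tensorRight Ω₁ y).adjoint f⟫_ℂ = ⟪tensorForm Ω₁ Ω₂ x y, f⟫_ℂ :=
  ContinuousLinearMap.adjoint_inner_right _ _ _

theorem inner_adjoint_tensorLeft (x : Ω₁.L2Forms) (y : Ω₂.L2Forms) (f : (Ω₁.prod Ω₂).L2Forms) :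
    ⟪y, (tensorLeft Ω₂ x).adjoint f⟫_ℂ = ⟪tensorForm Ω₁ Ω₂ x y, f⟫_ℂ :=
  ContinuousLinearMap.adjoint_inner_right _ _ _

theorem tensorForm_zero_left (y : Ω₂.L2Forms) : tensorForm Ω₁ Ω₂ 0 y = 0 :=
  map_zero (tensorRight Ω₁ y)

theorem tensorForm_zero_right (x : Ω₁.L2Forms) : tensorForm Ω₁ Ω₂ x 0 = 0 :=
  map_zero (tensorLeft Ω₂ x)

theorem tensorForm_neg_left (x : Ω₁.L2Forms) (y : Ω₂.L2Forms) :
    tensorForm Ω₁ Ω₂ (-x) y = -tensorForm Ω₁ Ω₂ x y := map_neg (tensorRight Ω₁ y) x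

theorem tensorForm_sub_left (x x' : Ω₁.L2Forms) (y : Ω₂.L2Forms) :
    tensorForm Ω₁ Ω₂ (x - x') y = tensorForm Ω₁ Ω₂ x y - tensorForm Ω₁ Ω₂ x' y :=
  map_sub (tensorRight Ω₁ y) x x'

theorem tensorForm_sub_right (x : Ω₁.L2Forms) (y y' : Ω₂.L2Forms) :
    tensorForm Ω₁ Ω₂ x (y - y') = tensorForm Ω₁ Ω₂ x y - tensorForm Ω₁ Ω₂ x y' :=
  map_sub (tensorLeft Ω₂ x) y y'

theorem IsTest.mulFun {a : (ι₁ → ℂ) → ℂ} {b : (ι₂ → ℂ) → ℂ} (ha : Ω₁.IsTest a)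
    (hb : Ω₂.IsTest b) : (Ω₁.prod Ω₂).IsTest (mulFun a b) := by
  have hK : IsCompact (join '' (tsupport a ×ˢ tsupport b)) :=
    (ha.hasCompactSupport.isCompact.prod hb.hasCompactSupport.isCompact).image continuous_join
  have hs : Function.support (WeightedDomain.mulFun a b) ⊆ join '' (tsupport a ×ˢ tsupport b) :=
    fun x hx => ⟨split x, ⟨subset_tsupport a (left_ne_zero_of_mul hx),
      subset_tsupport b (right_ne_zero_of_mul hx)⟩, join_split x⟩
  refine ⟨contDiff_mulFun ha.contDiff hb.contDiff,
    HasCompactSupport.of_support_subset_isCompact hK hs,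
    (closure_minimal hs hK.isClosed).trans ?_⟩
  rintro _ ⟨x, hx, rfl⟩
  exact ⟨ha.tsupport_subset hx.1, hb.tsupport_subset hx.2⟩

theorem IsTest.lp_mulFun {a : (ι₁ → ℂ) → ℂ} {b : (ι₂ → ℂ) → ℂ} (ha : Ω₁.IsTest a)
    (hb : Ω₂.IsTest b) : (ha.mulFun hb).lp = mulLp Ω₁ Ω₂ ha.lp hb.lp := by
  refine Lp.ext ?_
  filter_upwards [mulLp_coeFn Ω₁ Ω₂ ha.lp hb.lp, MemLp.coeFn_toLp ((Ω₁.prod Ω₂).memLp_test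
      (ha.mulFun hb).contDiff.continuous (ha.mulFun hb).hasCompactSupport),
    ae_split Ω₁ Ω₂ (MemLp.coeFn_toLp (Ω₁.memLp_test ha.contDiff.continuous ha.hasCompactSupport))
      (MemLp.coeFn_toLp (Ω₂.memLp_test hb.contDiff.continuous hb.hasCompactSupport))]
    with x h1 h2 h3
  rw [h1, IsTest.lp, h2, IsTest.lp, h3.1, IsTest.lp, h3.2]
  simp only [WeightedDomain.mulFun, prod, map_mul, Real.exp_add, Complex.ofReal_mul]
  ring

variable [LinearOrder ι₁] [LinearOrder ι₂]

theorem tensorForm_singleForm (A : Finset (ι₁ ⊕ₗ ι₂) × Finset (ι₁ ⊕ₗ ι₂))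
    (a : Lp ℂ 2 Ω₁.measure) (b : Lp ℂ 2 Ω₂.measure) :
    tensorForm Ω₁ Ω₂ (Ω₁.singleForm (leftPart A.1, leftPart A.2) a)
        (Ω₂.singleForm (rightPart A.1, rightPart A.2) b) =
      (-1 : ℂ) ^ ((leftPart A.2).card * (rightPart A.1).card) •
        (Ω₁.prod Ω₂).singleForm A (mulLp Ω₁ Ω₂ a b) := by
  ext1 B
  rw [PiLp.smul_apply, singleForm_apply, tensorForm, PiLp.toLp_apply, singleForm_apply,
    singleForm_apply]
  by_cases h : B = A
  · simp [h]
  · rw [if_neg h]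
    by_cases h1 : (leftPart B.1, leftPart B.2) = (leftPart A.1, leftPart A.2)
    · by_cases h2 : (rightPart B.1, rightPart B.2) = (rightPart A.1, rightPart A.2)
      · simp only [Prod.mk.injEq] at h1 h2
        exact absurd (Prod.ext (parts_inj h1.1 h2.1) (parts_inj h1.2 h2.2)) h
      · rw [if_neg h2, mulLp_zero_right, smul_zero, smul_zero]
    · rw [if_neg h1, mulLp_zero_left, smul_zero, smul_zero]

/-- A test form whose coefficient is a product is, up to sign, a tensor product of test forms. -/
theorem testForm_mulFun (I L : Finset (ι₁ ⊕ₗ ι₂)) {a : (ι₁ → ℂ) → ℂ} {b : (ι₂ → ℂ) → ℂ}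
    (ha : Ω₁.IsTest a) (hb : Ω₂.IsTest b) :
    testForm I L (ha.mulFun hb) = (-1 : ℂ) ^ ((leftPart L).card * (rightPart I).card) •
      tensorForm Ω₁ Ω₂ (testForm (leftPart I) (leftPart L) ha)
        (testForm (rightPart I) (rightPart L) hb) := by
  rw [testForm, testForm, testForm, tensorForm_singleForm (I, L), smul_smul, ← mul_pow,
    IsTest.lp_mulFun ha hb, neg_one_mul, neg_neg, one_pow, one_smul]
  rfl

theorem IsTest.lp_congr {ι : Type*} [Fintype ι] {Ω : WeightedDomain ι} {a b : (ι → ℂ) → ℂ}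
    (ha : Ω.IsTest a) (hb : Ω.IsTest b) (h : a = b) : ha.lp = hb.lp := by
  subst h; rfl

/-- The Leibniz rule for the formal adjoint of `∂̄`. The sign `σ₁` comes from moving `dw̄_k` past the
form on the first factor. -/
theorem testFormAdjoint_mulFun (I L : Finset (ι₁ ⊕ₗ ι₂)) {a : (ι₁ → ℂ) → ℂ} {b : (ι₂ → ℂ) → ℂ}
    (ha : Ω₁.IsTest a) (hb : Ω₂.IsTest b) :
    testFormAdjoint I L (ha.mulFun hb) = (-1 : ℂ) ^ ((leftPart L).card * (rightPart I).card) •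
      (tensorForm Ω₁ Ω₂ (testFormAdjoint (leftPart I) (leftPart L) ha)
        (testForm (rightPart I) (rightPart L) hb) +
      tensorForm Ω₁ Ω₂ (Ω₁.sigma (testForm (leftPart I) (leftPart L) ha))
        (testFormAdjoint (rightPart I) (rightPart L) hb)) := by
  have hda := ha.contDiff.differentiable (by simp)
  have hdb := hb.contDiff.differentiable (by simp)
  have hl : ∀ k, ((ha.mulFun hb).dzbar (Sum.inlₗ k)).lp = mulLp Ω₁ Ω₂ (ha.dzbar k).lp hb.lp :=
    fun k => (IsTest.lp_congr _ _ (dzbar_mulFun_inl hda hdb k)).trans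
      (IsTest.lp_mulFun (ha.dzbar k) hb)
  have hr : ∀ k, ((ha.mulFun hb).dzbar (Sum.inrₗ k)).lp = mulLp Ω₁ Ω₂ ha.lp (hb.dzbar k).lp :=
    fun k => (IsTest.lp_congr _ _ (dzbar_mulFun_inr hda hdb k)).trans
      (IsTest.lp_mulFun ha (hb.dzbar k))
  rw [← tensorRight_apply _ (testForm _ _ hb), ← tensorLeft_apply (Ω₁.sigma _)]
  simp only [testFormAdjoint, map_neg, map_sum, map_smul]
  rw [sum_parts, neg_add, smul_add, smul_neg, smul_neg, Finset.smul_sum, Finset.smul_sum]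
  congr 2
  · refine Finset.sum_congr rfl fun k hk => ?_
    have h := tensorForm_singleForm (I, L.erase (Sum.inlₗ k)) (ha.dzbar k).lp hb.lp
    simp only [leftPart_erase_inl, rightPart_erase_inl] at h
    rw [tensorRight_apply, testForm, h, hl, dbarSign_inl, smul_smul, smul_smul]
    congr 1
    rw [← Finset.card_erase_add_one hk, add_mul, one_mul, pow_add]
    have e : ∀ n : ℕ, ((-1 : ℂ) ^ n) * (-1) ^ n = 1 := fun n => by rw [← mul_pow]; simp
    linear_combination (-(-1 : ℂ) ^ (rightPart I).card *
      dbarSign k (leftPart I) (leftPart L)) * e (((leftPart L).erase k).card * (rightPart I).card)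
  · refine Finset.sum_congr rfl fun k hk => ?_
    have h := tensorForm_singleForm (I, L.erase (Sum.inrₗ k)) ha.lp (hb.dzbar k).lp
    simp only [leftPart_erase_inr, rightPart_erase_inr] at h
    rw [tensorLeft_apply, testForm, sigma_singleForm, ← tensorRight_apply, map_smul,
      tensorRight_apply, h, hr, dbarSign_inr, smul_smul, smul_smul, smul_smul]
    congr 1
    have e : ∀ n : ℕ, ((-1 : ℂ) ^ n) * (-1) ^ n = 1 := fun n => by rw [← mul_pow]; simp
    linear_combination (-(-1 : ℂ) ^ ((leftPart I).card + (leftPart L).card) *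
      dbarSign k (rightPart I) (rightPart L)) * e ((leftPart L).card * (rightPart I).card)

/-- `∂̄` on a product domain is the Hilbert space adjoint of
`∂̄₁† ⊗ 1 + σ₁ ⊗ ∂̄₂†` on products of test forms. -/
theorem dbar_prod_graph_of_test {f g : (Ω₁.prod Ω₂).L2Forms}
    (h : ∀ (I₁ L₁ : Finset ι₁) (I₂ L₂ : Finset ι₂) (a : (ι₁ → ℂ) → ℂ) (b : (ι₂ → ℂ) → ℂ)
      (ha : Ω₁.IsTest a) (hb : Ω₂.IsTest b),
      ⟪tensorForm Ω₁ Ω₂ (testForm I₁ L₁ ha) (testForm I₂ L₂ hb), g⟫_ℂ =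
        ⟪tensorForm Ω₁ Ω₂ (testFormAdjoint I₁ L₁ ha) (testForm I₂ L₂ hb), f⟫_ℂ +
        ⟪tensorForm Ω₁ Ω₂ (Ω₁.sigma (testForm I₁ L₁ ha)) (testFormAdjoint I₂ L₂ hb), f⟫_ℂ) :
    (f, g) ∈ (Ω₁.prod Ω₂).dbar.graph := by
  rw [mem_dbar_graph]
  intro I L ψ hψ
  refine eq_neg_of_add_eq_zero_left (weak_equation_of_mulFun Ω₁ Ω₂
    ((Ω₁.prod Ω₂).integrableOn (g (I, L)))
    (F := fun k => (f (I, L.erase k) : ((ι₁ ⊕ₗ ι₂) → ℂ) → ℂ)) (fun k =>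
      (Ω₁.prod Ω₂).integrableOn (f (I, L.erase k))) L (fun k => dbarSign k I L) ?_ hψ)
  intro a b ha hb
  have h1 := inner_testForm I L (ha.mulFun hb) g
  have h2 := inner_testFormAdjoint I L (ha.mulFun hb) f
  rw [testForm_mulFun I L ha hb, inner_smul_left, h, ← inner_add_left, ← inner_smul_left,
    ← testFormAdjoint_mulFun I L ha hb, h2] at h1
  rw [← h1]
  exact neg_add_cancel _

theorem inner_tensorForm_of_graph_test {f g : (Ω₁.prod Ω₂).L2Forms}
    (h : (f, g) ∈ (Ω₁.prod Ω₂).dbar.graph) (I₁ L₁ : Finset ι₁) (I₂ L₂ : Finset ι₂)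
    {a : (ι₁ → ℂ) → ℂ} {b : (ι₂ → ℂ) → ℂ} (ha : Ω₁.IsTest a) (hb : Ω₂.IsTest b) :
    ⟪tensorForm Ω₁ Ω₂ (testForm I₁ L₁ ha) (testForm I₂ L₂ hb), g⟫_ℂ =
      ⟪tensorForm Ω₁ Ω₂ (testFormAdjoint I₁ L₁ ha) (testForm I₂ L₂ hb), f⟫_ℂ +
      ⟪tensorForm Ω₁ Ω₂ (Ω₁.sigma (testForm I₁ L₁ ha)) (testFormAdjoint I₂ L₂ hb), f⟫_ℂ := by
  obtain ⟨I, hI⟩ := partsEquiv.surjective (I₁, I₂)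
  obtain ⟨L, hL⟩ := partsEquiv.surjective (L₁, L₂)
  obtain ⟨rfl, rfl⟩ := Prod.mk.inj (show (leftPart I, rightPart I) = (I₁, I₂) from hI)
  obtain ⟨rfl, rfl⟩ := Prod.mk.inj (show (leftPart L, rightPart L) = (L₁, L₂) from hL)
  have h1 := mem_dbar_graph_iff_inner.1 h I L _ (ha.mulFun hb)
  rw [testForm_mulFun I L ha hb, testFormAdjoint_mulFun I L ha hb, inner_smul_left, inner_smul_left,
    inner_add_left] at h1
  exact mul_left_cancel₀ (by simp) h1

/-- The algebraic tensor product of `dom ∂̄₁†` and `dom ∂̄₂†` lies in the domain of `∂̄†`. -/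
theorem tensorForm_adjoint_graph {x v : Ω₁.L2Forms} {y w : Ω₂.L2Forms}
    (hx : (x, v) ∈ Ω₁.dbar†.graph) (hy : (y, w) ∈ Ω₂.dbar†.graph) :
    (tensorForm Ω₁ Ω₂ x y, tensorForm Ω₁ Ω₂ v y + tensorForm Ω₁ Ω₂ (Ω₁.sigma x) w) ∈
      (Ω₁.prod Ω₂).dbar†.graph := by
  rw [(Ω₁.prod Ω₂).dbar_closedDenselyDefined.mem_adjoint_graph_iff]
  intro f g h
  -- contraction with a test form on the second factor gives a weak equation on the first factor
  have hb_weak : ∀ (I₂ L₂ : Finset ι₂) (b : (ι₂ → ℂ) → ℂ) (hb : Ω₂.IsTest b),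
      ((tensorRight Ω₁ (testForm I₂ L₂ hb)).adjoint f,
        (tensorRight Ω₁ (testForm I₂ L₂ hb)).adjoint g -
          Ω₁.sigma ((tensorRight Ω₁ (testFormAdjoint I₂ L₂ hb)).adjoint f)) ∈ Ω₁.dbar.graph := by
    intro I₂ L₂ b hb
    rw [mem_dbar_graph_iff_inner]
    intro I₁ L₁ a ha
    rw [inner_sub_right, ← inner_sigma_left, inner_adjoint_tensorRight, inner_adjoint_tensorRight,
      inner_adjoint_tensorRight, inner_tensorForm_of_graph_test h, add_sub_cancel_right]
  -- contraction with `x` then gives a weak equation on the second factor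
  have hx_weak : ((tensorLeft Ω₂ (Ω₁.sigma x)).adjoint f,
      (tensorLeft Ω₂ x).adjoint g - (tensorLeft Ω₂ v).adjoint f) ∈ Ω₂.dbar.graph := by
    rw [mem_dbar_graph_iff_inner]
    intro I₂ L₂ b hb
    have := Ω₁.dbar_closedDenselyDefined.mem_adjoint_graph_iff.1 hx _ _ (hb_weak I₂ L₂ b hb)
    rw [inner_sub_right, ← inner_sigma_left, inner_adjoint_tensorRight, inner_adjoint_tensorRight,
      inner_adjoint_tensorRight] at this
    rw [inner_sub_right, inner_adjoint_tensorLeft, inner_adjoint_tensorLeft,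
      inner_adjoint_tensorLeft, ← this]
    ring
  have := Ω₂.dbar_closedDenselyDefined.mem_adjoint_graph_iff.1 hy _ _ hx_weak
  rw [inner_sub_right, inner_adjoint_tensorLeft, inner_adjoint_tensorLeft,
    inner_adjoint_tensorLeft] at this
  rw [inner_add_left, ← this]
  ring

/-- `∂̄` on a product domain is the Hilbert space adjoint of `∂̄₁† ⊗ 1 + σ₁ ⊗ ∂̄₂†` on the algebraic
tensor product of the domains. -/
theorem dbar_prod_graph_of_adjoint {f g : (Ω₁.prod Ω₂).L2Forms}
    (h : ∀ x v y w, (x, v) ∈ Ω₁.dbar†.graph → (y, w) ∈ Ω₂.dbar†.graph →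
      ⟪tensorForm Ω₁ Ω₂ x y, g⟫_ℂ =
        ⟪tensorForm Ω₁ Ω₂ v y + tensorForm Ω₁ Ω₂ (Ω₁.sigma x) w, f⟫_ℂ) :
    (f, g) ∈ (Ω₁.prod Ω₂).dbar.graph :=
  dbar_prod_graph_of_test fun I₁ L₁ I₂ L₂ _ _ ha hb => by
    rw [← inner_add_left]
    exact h _ _ _ _ (testForm_graph I₁ L₁ ha) (testForm_graph I₂ L₂ hb)

/-- Product forms span a dense subspace. -/
theorem eq_zero_of_inner_tensorForm {f : (Ω₁.prod Ω₂).L2Forms}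
    (h : ∀ x y, ⟪tensorForm Ω₁ Ω₂ x y, f⟫_ℂ = 0) : f = 0 := by
  have h0 : ((0 : (Ω₁.prod Ω₂).L2Forms), f) ∈ (Ω₁.prod Ω₂).dbar.graph :=
    dbar_prod_graph_of_adjoint fun x v y w _ _ => by rw [h, inner_zero_right]
  exact LinearPMap.graph_fst_eq_zero_snd _ h0 rfl

/-- The adjoint of `A ⊗ B` is `A† ⊗ B†` on product forms. -/
theorem inner_tensorOp (A : Ω₁.L2Forms →L[ℂ] Ω₁.L2Forms) (B : Ω₂.L2Forms →L[ℂ] Ω₂.L2Forms)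
    (x : Ω₁.L2Forms) (y : Ω₂.L2Forms) (f : (Ω₁.prod Ω₂).L2Forms) :
    ⟪tensorForm Ω₁ Ω₂ x y, tensorOp Ω₁ Ω₂ A B f⟫_ℂ =
      ⟪tensorForm Ω₁ Ω₂ (A.adjoint x) (B.adjoint y), f⟫_ℂ := by
  rw [← ContinuousLinearMap.adjoint_inner_left, ← sub_eq_zero, ← inner_sub_left]
  have : (tensorOp Ω₁ Ω₂ A B).adjoint (tensorForm Ω₁ Ω₂ x y) -
      tensorForm Ω₁ Ω₂ (A.adjoint x) (B.adjoint y) = 0 := by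
    refine eq_zero_of_inner_tensorForm fun x' y' => ?_
    rw [inner_sub_right, ContinuousLinearMap.adjoint_inner_right, tensorOp_tensorForm,
      inner_tensorForm, inner_tensorForm, ContinuousLinearMap.adjoint_inner_right,
      ContinuousLinearMap.adjoint_inner_right, sub_self]
  rw [this, inner_zero_left]

end Tensor

/-! ### The operator `S` -/

section Solution

variable {ι₁ ι₂ : Type*} [Fintype ι₁] [LinearOrder ι₁] [Fintype ι₂] [LinearOrder ι₂]
  {Ω₁ : WeightedDomain ι₁} {Ω₂ : WeightedDomain ι₂}
  (h₁ : Ω₁.HasClosedRange) (h₂ : Ω₂.HasClosedRange)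

theorem harmonicP_mem {ι : Type*} [Fintype ι] [LinearOrder ι] (Ω : WeightedDomain ι)
    (x : Ω.L2Forms) : Ω.harmonicP x ∈ harmonicSpace Ω.dbar :=
  Ω.dbar_closedDenselyDefined.harmonicProjection_mem x

theorem sigma_harmonicP {ι : Type*} [Fintype ι] [LinearOrder ι] (Ω : WeightedDomain ι)
    (x : Ω.L2Forms) : Ω.harmonicP (Ω.sigma x) = Ω.sigma (Ω.harmonicP x) :=
  Ω.dbar_closedDenselyDefined.harmonicProjection_grading Ω.inner_sigma_left sigma_graph x

theorem adjoint_harmonicP {ι : Type*} [Fintype ι] [LinearOrder ι] (Ω : WeightedDomain ι) :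
    Ω.harmonicP.adjoint = Ω.harmonicP :=
  ((ContinuousLinearMap.eq_adjoint_iff _ _).2
    Ω.dbar_closedDenselyDefined.inner_harmonicProjection_left).symm

theorem adjoint_sigma {ι : Type*} [Fintype ι] (Ω : WeightedDomain ι) :
    Ω.sigma.adjoint = Ω.sigma :=
  ((ContinuousLinearMap.eq_adjoint_iff _ _).2 Ω.inner_sigma_left).symm

/-- The adjoint of `S` on product forms. -/
theorem inner_solutionS (x : Ω₁.L2Forms) (y : Ω₂.L2Forms) (f : (Ω₁.prod Ω₂).L2Forms) :
    ⟪tensorForm Ω₁ Ω₂ x y, solutionS h₁ h₂ f⟫_ℂ =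
      ⟪tensorForm Ω₁ Ω₂ ((canonicalK h₁).adjoint x) y +
        tensorForm Ω₁ Ω₂ (Ω₁.harmonicP (Ω₁.sigma x)) ((canonicalK h₂).adjoint y), f⟫_ℂ := by
  rw [solutionS, add_apply, inner_add_right, inner_tensorOp, inner_tensorOp,
    inner_add_left, ContinuousLinearMap.adjoint_comp, adjoint_harmonicP, adjoint_sigma,
    ContinuousLinearMap.adjoint_id]
  rfl

/-- The homotopy formula `∂̄ S + S ∂̄ = 1 - P₁ ⊗ P₂`. -/
theorem solutionS_graph {f g : (Ω₁.prod Ω₂).L2Forms} (h : (f, g) ∈ (Ω₁.prod Ω₂).dbar.graph) :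
    (solutionS h₁ h₂ f, f - tensorOp Ω₁ Ω₂ Ω₁.harmonicP Ω₂.harmonicP f - solutionS h₁ h₂ g) ∈
      (Ω₁.prod Ω₂).dbar.graph := by
  have c₁ := Ω₁.dbar_closedDenselyDefined
  have c₂ := Ω₂.dbar_closedDenselyDefined
  refine dbar_prod_graph_of_adjoint fun x v y w hx hy => ?_
  -- `∂̄† (S† (x ⊗ y))`
  have hK₁ : ((canonicalK h₁).adjoint x, x - c₁.kerProjection x) ∈ Ω₁.dbar†.graph :=
    c₁.adjoint_canonicalSolution_graph h₁ x
  have hK₂ : ((canonicalK h₂).adjoint y, y - c₂.kerProjection y) ∈ Ω₂.dbar†.graph :=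
    c₂.adjoint_canonicalSolution_graph h₂ y
  have hP : (Ω₁.harmonicP (Ω₁.sigma x), (0 : Ω₁.L2Forms)) ∈ Ω₁.dbar†.graph :=
    mem_kerOp.1 (Ω₁.harmonicP_mem (Ω₁.sigma x)).2
  have e1 := (Ω₁.prod Ω₂).dbar_closedDenselyDefined.mem_adjoint_graph_iff.1
    ((Ω₁.prod Ω₂).dbar†.graph.add_mem (tensorForm_adjoint_graph hK₁ hy)
      (tensorForm_adjoint_graph hP hK₂)) f g h
  -- `S† (∂̄† (x ⊗ y))`
  have a1 : (canonicalK h₁).adjoint v = c₁.rangeProjection h₁ x :=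
    c₁.adjoint_canonicalSolution_of_graph h₁ hx
  have a2 : (canonicalK h₂).adjoint w = c₂.rangeProjection h₂ y :=
    c₂.adjoint_canonicalSolution_of_graph h₂ hy
  have a3 : Ω₁.harmonicP (Ω₁.sigma v) = 0 := by
    rw [sigma_harmonicP, harmonicP, c₁.harmonicProjection_of_adjoint_graph hx, map_zero]
  have a4 : (canonicalK h₁).adjoint (Ω₁.sigma x) = -Ω₁.sigma ((canonicalK h₁).adjoint x) :=
    c₁.adjoint_canonicalSolution_grading h₁ Ω₁.inner_sigma_left sigma_graph x
  have p1 : Ω₁.harmonicP x = c₁.kerProjection x - c₁.rangeProjection h₁ x :=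
    c₁.harmonicProjection_eq h₁ Ω₁.dbar_range_le_ker x
  have p2 : Ω₂.harmonicP y = c₂.kerProjection y - c₂.rangeProjection h₂ y :=
    c₂.harmonicProjection_eq h₂ Ω₂.dbar_range_le_ker y
  rw [inner_sub_right, inner_sub_right, inner_solutionS, inner_add_left (tensorForm Ω₁ Ω₂ v y),
    inner_solutionS, inner_solutionS, inner_tensorOp, adjoint_harmonicP, adjoint_harmonicP]
  change ⟪tensorForm Ω₁ Ω₂ ((canonicalK h₁).adjoint x) y +
        tensorForm Ω₁ Ω₂ (Ω₁.harmonicP (Ω₁.sigma x)) ((canonicalK h₂).adjoint y), g⟫_ℂ = _ at e1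
  rw [e1, a1, a2, a3, a4, sigma_sigma, ← sigma_harmonicP, sigma_sigma, tensorForm_zero_left,
    p1, p2, tensorForm_neg_left]
  simp only [tensorForm_sub_left, tensorForm_sub_right, inner_add_left, inner_sub_left,
    inner_neg_left, inner_zero_left]
  ring

/-- `P₁ ⊗ P₂` annihilates the range of `∂̄`. -/
theorem tensorOp_harmonicP_of_graph {f g : (Ω₁.prod Ω₂).L2Forms}
    (h : (f, g) ∈ (Ω₁.prod Ω₂).dbar.graph) :
    tensorOp Ω₁ Ω₂ Ω₁.harmonicP Ω₂.harmonicP g = 0 := by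
  refine eq_zero_of_inner_tensorForm fun x y => ?_
  have hP := (Ω₁.prod Ω₂).dbar_closedDenselyDefined.mem_adjoint_graph_iff.1
    (tensorForm_adjoint_graph
      (mem_kerOp.1 (Ω₁.harmonicP_mem x).2)
      (mem_kerOp.1 (Ω₂.harmonicP_mem y).2)) f g h
  rw [inner_tensorOp, adjoint_harmonicP, adjoint_harmonicP]
  refine hP.trans ?_
  rw [tensorForm_zero_left, tensorForm_zero_right, add_zero, inner_zero_left]

/-- The range of `P₁ ⊗ P₂` lies in the kernel of `∂̄†`, that is, it is orthogonal to the range of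
`∂̄`. -/
theorem tensorOp_harmonicP_mem (f : (Ω₁.prod Ω₂).L2Forms) :
    tensorOp Ω₁ Ω₂ Ω₁.harmonicP Ω₂.harmonicP f ∈ (rangeOp (Ω₁.prod Ω₂).dbar)ᗮ := by
  rw [Submodule.mem_orthogonal]
  intro g hg
  obtain ⟨u, hu⟩ := mem_rangeOp.1 hg
  have hs : (tensorOp Ω₁ Ω₂ Ω₁.harmonicP Ω₂.harmonicP).adjoint =
      tensorOp Ω₁ Ω₂ Ω₁.harmonicP Ω₂.harmonicP := by
    ext1 k
    refine sub_eq_zero.1 (eq_zero_of_inner_tensorForm fun x y => ?_)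
    rw [inner_sub_right, ContinuousLinearMap.adjoint_inner_right, tensorOp_tensorForm,
      inner_tensorOp, adjoint_harmonicP, adjoint_harmonicP, sub_self]
  rw [← ContinuousLinearMap.adjoint_inner_left, hs, tensorOp_harmonicP_of_graph hu,
    inner_zero_left]

include h₁ h₂ in
/-- The range of `∂̄` on the product is the intersection of the kernels of `∂̄` and `P₁ ⊗ P₂`. -/
theorem rangeOp_prod_eq : rangeOp (Ω₁.prod Ω₂).dbar = kerOp (Ω₁.prod Ω₂).dbar ⊓
    LinearMap.ker (tensorOp Ω₁ Ω₂ Ω₁.harmonicP Ω₂.harmonicP).toLinearMap := by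
  ext g
  constructor
  · intro hg
    obtain ⟨u, hu⟩ := mem_rangeOp.1 hg
    exact ⟨(Ω₁.prod Ω₂).dbar_range_le_ker hg, tensorOp_harmonicP_of_graph hu⟩
  · intro hg
    have h := solutionS_graph h₁ h₂ (mem_kerOp.1 hg.1)
    have h0 : tensorOp Ω₁ Ω₂ Ω₁.harmonicP Ω₂.harmonicP g = 0 := hg.2
    rw [h0, map_zero, sub_zero, sub_zero] at h
    exact mem_rangeOp.2 ⟨_, h⟩

include h₁ h₂ in
theorem prod_hasClosedRange : (Ω₁.prod Ω₂).HasClosedRange := by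
  rw [HasClosedRange, rangeOp_prod_eq h₁ h₂]
  exact (isClosed_kerOp (Ω₁.prod Ω₂).dbar_isClosed).inter (ContinuousLinearMap.isClosed_ker _)

/-- Forms of bidegree `(p, 1)` have no component of positive degree in `dz̄` and in `dw̄`. -/
theorem inner_sub_degreeZero {p : ℕ} {f : (Ω₁.prod Ω₂).L2Forms} (hf : f ∈ (Ω₁.prod Ω₂).bidegree p 1)
    (x : Ω₁.L2Forms) (y : Ω₂.L2Forms) :
    ⟪tensorForm Ω₁ Ω₂ (x - Ω₁.degreeZero x) (y - Ω₂.degreeZero y), f⟫_ℂ = 0 := by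
  rw [PiLp.inner_apply]
  refine Finset.sum_eq_zero fun A _ => ?_
  by_cases h : A.1.card = p ∧ A.2.card = 1
  · have h1 : leftPart A.2 = ∅ ∨ rightPart A.2 = ∅ := by
      have := h.2
      rw [card_parts] at this
      rw [← Finset.card_eq_zero, ← Finset.card_eq_zero]
      omega
    rw [tensorForm, PiLp.toLp_apply]
    rcases h1 with h1 | h1
    · have h0 : (x - Ω₁.degreeZero x) (leftPart A.1, leftPart A.2) = 0 := by
        rw [PiLp.sub_apply, degreeZero_apply, if_pos h1, sub_self]
      rw [h0, mulLp_zero_left, smul_zero, inner_zero_left]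
    · have h0 : (y - Ω₂.degreeZero y) (rightPart A.1, rightPart A.2) = 0 := by
        rw [PiLp.sub_apply, degreeZero_apply, if_pos h1, sub_self]
      rw [h0, mulLp_zero_right, smul_zero, inner_zero_left]
  · rw [show f A = 0 from hf A.1 A.2 h, inner_zero_right]

theorem canonicalK_degreeZero {ι : Type*} [Fintype ι] [LinearOrder ι] {Ω : WeightedDomain ι}
    (h : Ω.HasClosedRange) (x : Ω.L2Forms) : canonicalK h (Ω.degreeZero x) = 0 :=
  Ω.dbar_closedDenselyDefined.canonicalSolution_eq_zero h (degreeZero_mem x)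

theorem degreeZero_adjoint_canonicalK {ι : Type*} [Fintype ι] [LinearOrder ι]
    {Ω : WeightedDomain ι} (h : Ω.HasClosedRange) (x : Ω.L2Forms) :
    Ω.degreeZero ((canonicalK h).adjoint x) = 0 := by
  refine ext_inner_right ℂ fun y => ?_
  rw [inner_degreeZero_left, ContinuousLinearMap.adjoint_inner_left, canonicalK_degreeZero,
    inner_zero_right, inner_zero_left]

/-- On `(p, 1)`-forms, `K₁ ⊗ 1` may be replaced by `K₁ ⊗ E₂`, where `E₂` is the projection onto
bidegrees `(·, 0)`. -/
theorem tensorOp_canonicalK_eq {p : ℕ} {f : (Ω₁.prod Ω₂).L2Forms}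
    (hf : f ∈ (Ω₁.prod Ω₂).bidegree p 1) :
    tensorOp Ω₁ Ω₂ (canonicalK h₁) (ContinuousLinearMap.id ℂ _) f =
      tensorOp Ω₁ Ω₂ (canonicalK h₁) Ω₂.degreeZero f := by
  refine sub_eq_zero.1 (eq_zero_of_inner_tensorForm fun x y => ?_)
  have hE : Ω₂.degreeZero.adjoint = Ω₂.degreeZero :=
    ((ContinuousLinearMap.eq_adjoint_iff _ _).2 Ω₂.inner_degreeZero_left).symm
  have h := inner_sub_degreeZero hf ((canonicalK h₁).adjoint x) y
  rw [degreeZero_adjoint_canonicalK, sub_zero, tensorForm_sub_right, inner_sub_left] at h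
  rw [inner_sub_right, inner_tensorOp, inner_tensorOp, hE, ContinuousLinearMap.adjoint_id]
  exact h

/-- A bounded operator `A ⊗ B` whose values on product forms are orthogonal to `k` has range
orthogonal to `k`. -/
theorem inner_tensorOp_eq_zero {A : Ω₁.L2Forms →L[ℂ] Ω₁.L2Forms} {B : Ω₂.L2Forms →L[ℂ] Ω₂.L2Forms}
    {k : (Ω₁.prod Ω₂).L2Forms} (h : ∀ x y, ⟪tensorForm Ω₁ Ω₂ (A x) (B y), k⟫_ℂ = 0)
    (f : (Ω₁.prod Ω₂).L2Forms) : ⟪k, tensorOp Ω₁ Ω₂ A B f⟫_ℂ = 0 := by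
  rw [← ContinuousLinearMap.adjoint_inner_left]
  have : (tensorOp Ω₁ Ω₂ A B).adjoint k = 0 := by
    refine eq_zero_of_inner_tensorForm fun x y => ?_
    rw [ContinuousLinearMap.adjoint_inner_right, tensorOp_tensorForm, h]
  rw [this, inner_zero_left]

/-- If `k` is `∂̄`-closed, its contraction with `y ∈ ker ∂̄₂†` is `∂̄₁`-closed, hence orthogonal to
the range of `K₁`. -/
theorem inner_tensorForm_canonicalK_left {k : (Ω₁.prod Ω₂).L2Forms}
    (hk : k ∈ kerOp (Ω₁.prod Ω₂).dbar) (x : Ω₁.L2Forms) {y : Ω₂.L2Forms}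
    (hy : y ∈ kerOp Ω₂.dbar†) : ⟪tensorForm Ω₁ Ω₂ (canonicalK h₁ x) y, k⟫_ℂ = 0 := by
  have hmem : (tensorRight Ω₁ y).adjoint k ∈ kerOp Ω₁.dbar := by
    rw [mem_kerOp, mem_dbar_graph_iff_inner]
    intro I L ψ h
    have := (Ω₁.prod Ω₂).dbar_closedDenselyDefined.mem_adjoint_graph_iff.1
      (tensorForm_adjoint_graph (testForm_graph I L h) (mem_kerOp.1 hy)) k 0 (mem_kerOp.1 hk)
    rw [tensorForm_zero_right, add_zero] at this
    rw [inner_adjoint_tensorRight, ← this, inner_zero_right, inner_zero_right]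
  rw [← inner_adjoint_tensorRight]
  exact Submodule.inner_left_of_mem_orthogonal hmem
    (Ω₁.dbar_closedDenselyDefined.canonicalSolution_mem h₁ x)

/-- If `k` is `∂̄`-closed, its contraction with `x ∈ ker ∂̄₁†` is `∂̄₂`-closed up to the sign `σ₁`,
hence orthogonal to the range of `K₂`. -/
theorem inner_tensorForm_canonicalK_right {k : (Ω₁.prod Ω₂).L2Forms}
    (hk : k ∈ kerOp (Ω₁.prod Ω₂).dbar) {x : Ω₁.L2Forms} (y : Ω₂.L2Forms)
    (hx : x ∈ kerOp Ω₁.dbar†) :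
    ⟪tensorForm Ω₁ Ω₂ (Ω₁.sigma x) (canonicalK h₂ y), k⟫_ℂ = 0 := by
  have hmem : (tensorLeft Ω₂ (Ω₁.sigma x)).adjoint k ∈ kerOp Ω₂.dbar := by
    rw [mem_kerOp, mem_dbar_graph_iff_inner]
    intro I L ψ h
    have := (Ω₁.prod Ω₂).dbar_closedDenselyDefined.mem_adjoint_graph_iff.1
      (tensorForm_adjoint_graph (mem_kerOp.1 hx) (testForm_graph I L h)) k 0 (mem_kerOp.1 hk)
    rw [tensorForm_zero_left, zero_add] at this
    rw [inner_adjoint_tensorLeft, ← this, inner_zero_right, inner_zero_right]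
  rw [← inner_adjoint_tensorLeft]
  exact Submodule.inner_left_of_mem_orthogonal hmem
    (Ω₂.dbar_closedDenselyDefined.canonicalSolution_mem h₂ y)

/-- On `(p, 1)`-forms, the values of `S` are orthogonal to the kernel of `∂̄`. -/
theorem solutionS_mem {p : ℕ} {f : (Ω₁.prod Ω₂).L2Forms} (hf : f ∈ (Ω₁.prod Ω₂).bidegree p 1) :
    solutionS h₁ h₂ f ∈ (kerOp (Ω₁.prod Ω₂).dbar)ᗮ := by
  rw [Submodule.mem_orthogonal]
  intro k hk
  have e1 : ⟪k, tensorOp Ω₁ Ω₂ (canonicalK h₁) Ω₂.degreeZero f⟫_ℂ = 0 := by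
    refine inner_tensorOp_eq_zero (fun x y => ?_) f
    exact inner_tensorForm_canonicalK_left h₁ hk x
      (Ω₂.dbar_closedDenselyDefined.mem_kerOp_adjoint_iff.2 (degreeZero_mem y))
  have e2 : ⟪k, tensorOp Ω₁ Ω₂ (Ω₁.sigma ∘L Ω₁.harmonicP) (canonicalK h₂) f⟫_ℂ = 0 := by
    refine inner_tensorOp_eq_zero (fun x y => ?_) f
    rw [ContinuousLinearMap.comp_apply]
    exact inner_tensorForm_canonicalK_right h₂ hk y (Ω₁.harmonicP_mem x).2
  have e : solutionS h₁ h₂ f = tensorOp Ω₁ Ω₂ (canonicalK h₁) (ContinuousLinearMap.id ℂ _) f +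
      tensorOp Ω₁ Ω₂ (Ω₁.sigma ∘L Ω₁.harmonicP) (canonicalK h₂) f := rfl
  rw [e, tensorOp_canonicalK_eq h₁ hf, inner_add_right, e1, e2, add_zero]

/-- On closed `(p, 1)`-forms, `S` is the canonical solution operator. -/
theorem solutionS_eq_canonicalK {p : ℕ} {f : (Ω₁.prod Ω₂).L2Forms}
    (hf : f ∈ (Ω₁.prod Ω₂).bidegree p 1) (hk : f ∈ kerOp (Ω₁.prod Ω₂).dbar) :
    solutionS h₁ h₂ f = canonicalK (prod_hasClosedRange h₁ h₂) f := by
  have h := solutionS_graph h₁ h₂ (mem_kerOp.1 hk)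
  rw [map_zero, sub_zero] at h
  have e : canonicalK (prod_hasClosedRange h₁ h₂)
      (f - tensorOp Ω₁ Ω₂ Ω₁.harmonicP Ω₂.harmonicP f) = solutionS h₁ h₂ f :=
    (Ω₁.prod Ω₂).dbar_closedDenselyDefined.canonicalSolution_eq (prod_hasClosedRange h₁ h₂)
      h (solutionS_mem h₁ h₂ hf)
  have e0 : canonicalK (prod_hasClosedRange h₁ h₂)
      (tensorOp Ω₁ Ω₂ Ω₁.harmonicP Ω₂.harmonicP f) = 0 :=
    (Ω₁.prod Ω₂).dbar_closedDenselyDefined.canonicalSolution_eq_zero _ (tensorOp_harmonicP_mem f)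
  rw [← e, map_sub, e0, sub_zero]

end Solution

end WeightedDomain

end

theorem mainTheorem2 {n₁ n₂ : ℕ} (Ω₁ : WeightedDomain (Fin n₁)) (Ω₂ : WeightedDomain (Fin n₂))
    (hL₁ : HasLipschitzBoundary Ω₁.carrier) (hL₂ : HasLipschitzBoundary Ω₂.carrier)
    (h₁ : Ω₁.HasClosedRange) (h₂ : Ω₂.HasClosedRange) :
    ∃ (h : (Ω₁.prod Ω₂).HasClosedRange)
      (N : (Ω₁.prod Ω₂).L2Forms →L[ℂ] (Ω₁.prod Ω₂).L2Forms),
      IsNeumannOperator (Ω₁.prod Ω₂).dbar_closedDenselyDefined N ∧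
      ∀ p : ℕ,
        (∀ f ∈ (Ω₁.prod Ω₂).bidegree p 1, f ∈ kerOp (Ω₁.prod Ω₂).dbar →
          (N f, WeightedDomain.solutionS h₁ h₂ f) ∈ (Ω₁.prod Ω₂).dbar†.graph ∧
          WeightedDomain.solutionS h₁ h₂ f = WeightedDomain.canonicalK h f) ∧
        (∀ f ∈ (Ω₁.prod Ω₂).bidegree p 1, f ∈ harmonicSpace (Ω₁.prod Ω₂).dbar →
          WeightedDomain.solutionS h₁ h₂ f = 0) ∧
        (∀ f ∈ (Ω₁.prod Ω₂).bidegree p 1,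
          WeightedDomain.solutionS h₁ h₂ f ∈ (kerOp (Ω₁.prod Ω₂).dbar)ᗮ) := by
  have c := (Ω₁.prod Ω₂).dbar_closedDenselyDefined
  have h2 := (Ω₁.prod Ω₂).dbar_range_le_ker
  have h := WeightedDomain.prod_hasClosedRange h₁ h₂
  refine ⟨h, c.neumann h, c.isNeumannOperator_neumann h h2, fun p => ⟨fun f hf hk => ?_,
    fun f hf hh => ?_, fun f hf => WeightedDomain.solutionS_mem h₁ h₂ hf⟩⟩
  · have e := WeightedDomain.solutionS_eq_canonicalK h₁ h₂ hf hk
    exact ⟨e ▸ c.neumann_adjoint_graph h h2 f, e⟩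
  · rw [WeightedDomain.solutionS_eq_canonicalK h₁ h₂ hf hh.1]
    exact c.canonicalSolution_eq_zero h (c.mem_kerOp_adjoint_iff.1 hh.2)
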